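/- All Hilbert spaces are finite-dimensional, $\|\cdot\|_1$ is the trace norm, $U_m$ is the uniform distribution on $\{0,1\}^m$ (the maximally mixed state of $m$ qubits), $\mathrm{id}$ is the identity, and a missing register denotes a partial trace. For a state $\rho_{AE}$ let $$H_{\min}(A|E)_\rho=-\inf_{\tau_E}\ \inf\{\lambda\in\mathbb{R}:\rho_{AE}\le 2^{\lambda}(\mathrm{id}_A\otimes\tau_E)\},$$ where $\tau_E$ ranges over all states of $E$. *Extractors.* Let $X,\hat X,Y,\hat Y,X',\hat X',Y',\hat Y'$ be $n$-qubit registers. A *$(k_1,k_2)$-qma-state* is a pure state $\sigma_{X\hat XNMY\hat Y}$ in which $X,Y$ are classical with copies $\hat X,\hat Y$ (that is, measuring in the computational basis gives $X=\hat X$ and $Y=\hat Y$ with probability $1$), such that $H_{\min}(X|MY\hat Y)_\sigma\ge k_1$ and $H_{\min}(Y|NX\hat X)_\sigma\ge k_2$. A *$(k_1,k_2)$-qnm-state* is a state $\rho=(U\otimes V)\sigma(U\otimes V)^\dagger$, where $\sigma$ is a $(k_1,k_2)$-qma-state and $U:\mathcal H_X\otimes\mathcal H_N\to\mathcal H_X\otimes\mathcal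 H_{X'}\otimes\mathcal H_{\hat X'}\otimes\mathcal H_{N'}$ and $V:\mathcal H_Y\otimes\mathcal H_M\to\mathcal H_Y\otimes\mathcal H_{Y'}\otimes\mathcal H_{\hat Y'}\otimes\mathcal H_{M'}$ are isometries that are safe on $X$ and on $Y$, respectively ($U(|x\rangle\otimes|\phi\rangle)=|x\rangle\otimes U_x|\phi\rangle$ with isometries $U_x$, and likewise for $V$), such that in $\rho$ the registers $X',Y'$ are classical with copies $\hat X',\hat Y'$, and $\Pr(X\ne X')_\rho=1$ or $\Pr(Y\ne Y')_\rho=1$. A function $E:\{0,1\}^n\times\{0,1\}^n\to\{0,1\}^m$ is a *$(k_1,k_2,\varepsilon)$-quantum secure 2-source non-malleable extractor* if for every $(k_1,k_2)$-qnm-state $\rho$ $$\|\rho_{E(X,Y)\,E(X',Y')\,YY'M'}-U_m\otimes\rho_{E(X',Y')\,YY'M'}\|_1\le\varepsilon\quad\text{and}\quad\|\rho_{E(X,Y)\,E(X',Y')\,XX'N'}-U_m\otimes\rho_{E(X',Y')\,XX'N'}\|_1\le\varepsilon .$$ *Codes.* Let $\mathrm{Enc}:\{0,1\}^m\to\{0,1\}^n\times\{0,1\}^n$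 be a randomized function and $\mathrm{Dec}:\{0,1\}^n\times\{0,1\}^n\to\{0,1\}^m\cup\{\mathsf{same}\}$ a function. Put $\mathsf{copy}(\mathsf{same},s)=s$ and $\mathsf{copy}(x,s)=x$ for $x\ne\mathsf{same}$. The pair $(\mathrm{Enc},\mathrm{Dec})$ is an *$(m,n,\varepsilon')$-quantum secure non-malleable code in the split-state model* if $\Pr(\mathrm{Dec}(\mathrm{Enc}(s))=s)=1$ for all $s\in\{0,1\}^m$, and if for all registers $N,M,N',M'$, every pure state $\psi_{NM}$ and all isometries $U:\mathcal H_X\otimes\mathcal H_N\to\mathcal H_{X'}\otimes\mathcal H_{N'}$ and $V:\mathcal H_Y\otimes\mathcal H_M\to\mathcal H_{Y'}\otimes\mathcal H_{M'}$ there is a random variable $\mathcal D$ on $\{0,1\}^m\cup\{\mathsf{same}\}$ with $$\|\rho_{SS'}-Z\,\mathsf{copy}(\mathcal D,Z)\|_1\le\varepsilon',$$ where $Z$ is uniform on $\{0,1\}^m$ and independent of $\mathcal D$, and $\rho_{SS'}$ is obtained as follows: a uniform message $S$ is encoded as $(X,Y)=\mathrm{Enc}(S)$, which gives a state $\sigma_{SXY}$;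 then $U\otimes V$ is applied to $\sigma_{SXY}\otimes|\psi\rangle\langle\psi|_{NM}$; then $X',Y'$ are measured in the computational basis, and $S'=\mathrm{Dec}(X',Y')$. **Theorem.** Let $n\ge1$ and $m\ge0$ be integers and let $k\ge0$ and $\varepsilon$ be reals. Let $2\mathsf{nmExt}:\{0,1\}^n\times\{0,1\}^n\to\{0,1\}^m$ be a surjective $(n-k,n-k,\varepsilon)$-quantum secure 2-source non-malleable extractor. Let $\mathrm{Enc}(s)$ be uniformly distributed on $2\mathsf{nmExt}^{-1}(s)$ for every $s\in\{0,1\}^m$, and let $\mathrm{Dec}=2\mathsf{nmExt}$. Then $(\mathrm{Enc},\mathrm{Dec})$ is an $(m,n,\varepsilon')$-quantum secure non-malleable code in the split-state model with $$\varepsilon'=4(2^{-k}+\varepsilon)+\varepsilon .$$ -/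

import Mathlib

open scoped Kronecker ComplexOrder

noncomputable section

namespace SplitState

/-- `{0,1}^n`; the computational basis of an `n`-qubit register. A register is given by a finite
type `A`, its Hilbert space being `ℂ^A` with the elements of `A` as computational basis. -/
abbrev Bits (n : ℕ) : Type := Fin n → Bool

/-! ### Finite-dimensional quantum information -/

section Basics

variable {A B C E Z ι : Type*}

/-- Trace norm `‖A‖₁ = Tr (A† A)^{1/2}`: the sum of the singular values. -/
def traceNorm [Fintype ι] [DecidableEq ι] (A : Matrix ι ι ℂ) : ℝ :=
  ∑ i, Real.sqrt ((Matrix.isHermitian_conjTranspose_mul_self A).eigenvalues i)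

/-- Density matrices. -/
def IsDensity [Fintype ι] (ρ : Matrix ι ι ℂ) : Prop :=
  ρ.PosSemidef ∧ ρ.trace = 1

/-- `ψ` is a unit vector of `ℂ^ι`. -/
def IsUnitVector [Fintype ι] (ψ : ι → ℂ) : Prop :=
  ∑ i, ‖ψ i‖ ^ 2 = 1

/-- The rank-one matrix `|ψ⟩⟨ψ|`. -/
def ketbra (ψ : ι → ℂ) : Matrix ι ι ℂ :=
  Matrix.vecMulVec ψ (star ψ)

/-- `V : ℂ^A → ℂ^B` is an isometry: `V† V = id`. -/
def IsIsometry [Fintype B] [DecidableEq A] (V : Matrix B A ℂ) : Prop :=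
  V.conjTranspose * V = 1

/-- `V : X ⊗ A → X ⊗ B` is safe on `X`: there are isometries `W x : A → B` such that
`V (|x⟩ ⊗ |φ⟩) = |x⟩ ⊗ W x |φ⟩` for every `x` in the computational basis. -/
def IsSafe {X : Type*} [DecidableEq X] [Fintype B] [DecidableEq A]
    (V : Matrix (X × B) (X × A) ℂ) : Prop :=
  ∃ W : X → Matrix B A ℂ, (∀ x, IsIsometry (W x)) ∧
    ∀ x' b x a, V (x', b) (x, a) = if x' = x then W x b a else 0

/-- The marginal on the register `A` of a state on a system `ι` consisting of the registers `A`
and `B`, the latter being traced out; `g a b` is the basis element of the whole system with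
components `a` and `b`. -/
def partialTrace [Fintype B] (g : A → B → ι) (ρ : Matrix ι ι ℂ) : Matrix A A ℂ :=
  Matrix.of fun a a' => ∑ b, ρ (g a b) (g a' b)

/-- The state `ρ_{f(C) E}`: the register `C` is measured in the computational basis (which changes
nothing if `C` is already classical) and its content `c` is replaced by `f c`. For a
classical-quantum state `∑ c, p c |c⟩⟨c| ⊗ ρ^c` this is `∑ c, p c |f c⟩⟨f c| ⊗ ρ^c`. -/
def classicalMap [Fintype C] [DecidableEq Z] (f : C → Z) (ρ : Matrix (C × E) (C × E) ℂ) :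
    Matrix (Z × E) (Z × E) ℂ :=
  Matrix.of fun p q =>
    if p.1 = q.1 then ∑ c, if f c = p.1 then ρ (c, p.2) (c, q.2) else 0 else 0

/-- `Pr(P)` when the pure state `ψ` is measured in the computational basis. -/
def prob [Fintype ι] (ψ : ι → ℂ) (P : ι → Prop) : ℝ :=
  open Classical in ∑ i, if P i then ‖ψ i‖ ^ 2 else 0

/-- Max-divergence `inf {t : ρ ≤ 2^t σ}`, with value `⊤` if there is no such `t`. -/
def maxDivergence [Fintype ι] (ρ σ : Matrix ι ι ℂ) : EReal :=
  ⨅ t : {t : ℝ // ((((2 : ℝ) ^ t : ℝ) : ℂ) • σ - ρ).PosSemidef}, ((t : ℝ) : EReal)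

/-- Conditional min-entropy `H_min(A | E)_ρ = - inf_τ D_max(ρ_{AE} ‖ id_A ⊗ τ_E)`, the infimum
being over all states `τ` of the register `E`. -/
def condMinEntropy [Fintype A] [DecidableEq A] [Fintype E]
    (ρ : Matrix (A × E) (A × E) ℂ) : EReal :=
  - ⨅ τ : {τ : Matrix E E ℂ // IsDensity τ},
      maxDivergence ρ ((1 : Matrix A A ℂ) ⊗ₖ (τ : Matrix E E ℂ))

/-- The maximally mixed state `U_m` of an `m`-qubit register, that is the uniform distribution on
`{0,1}^m`. -/
def uniformState (m : ℕ) : Matrix (Bits m) (Bits m) ℂ :=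
  ((2 : ℂ) ^ m)⁻¹ • 1

/-- `‖τ_{SE} - U_m ⊗ τ_E‖₁` for a state `τ` of an `m`-qubit register `S` and a register `E`. -/
def distFromUniform {m : ℕ} [Fintype E] [DecidableEq E]
    (τ : Matrix (Bits m × E) (Bits m × E) ℂ) : ℝ :=
  traceNorm (τ - uniformState m ⊗ₖ partialTrace (fun (e : E) (s : Bits m) => (s, e)) τ)

end Basics

/-! ### Two-source non-malleable extractors -/

/-- The registers `X, N, Y, M, X̂, Ŷ`, in the order `(X N) (Y M) (X̂ Ŷ)`. -/
abbrev SourceReg (n : ℕ) (N M : Type) : Type :=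
  ((Bits n × N) × (Bits n × M)) × (Bits n × Bits n)

/-- The register `N` (or `M`) after tampering: `X' X̂' N'` (or `Y' Ŷ' M'`). -/
abbrev TamperedReg (n : ℕ) (N' : Type) : Type := Bits n × Bits n × N'

/-- `σ` is a `(k₁,k₂)`-qma-state: a pure state on `X X̂ N M Y Ŷ` in which `X̂`, `Ŷ` are copies of
`X`, `Y` (so that `X`, `Y` are classical), with `H_min(X | M Y Ŷ) ≥ k₁` and
`H_min(Y | N X X̂) ≥ k₂`. -/
structure IsQmaState {n : ℕ} {N M : Type} [Fintype N] [Fintype M] (k₁ k₂ : ℝ)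
    (σ : SourceReg n N M → ℂ) : Prop where
  unit : IsUnitVector σ
  copyX : prob σ (fun (((x, _), (_, _)), (xh, _)) => x = xh) = 1
  copyY : prob σ (fun (((_, _), (y, _)), (_, yh)) => y = yh) = 1
  entropyX : (k₁ : EReal) ≤ condMinEntropy
    (partialTrace
      (fun ((x, (m, y, yh)) : Bits n × (M × Bits n × Bits n)) ((ν, xh) : N × Bits n) =>
        (((x, ν), (y, m)), (xh, yh))) (ketbra σ))
  entropyY : (k₂ : EReal) ≤ condMinEntropy
    (partialTrace
      (fun ((y, (ν, x, xh)) : Bits n × (N × Bits n × Bits n)) ((m, yh) : M × Bits n) =>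
        (((x, ν), (y, m)), (xh, yh))) (ketbra σ))

/-- `ρ` is a `(k₁,k₂)`-qnm-state: it arises from a `(k₁,k₂)`-qma-state `σ` as `(U ⊗ V) σ (U ⊗ V)†`
with isometries `U : X N → X X' X̂' N'` and `V : Y M → Y Y' Ŷ' M'` (safe on the classical
registers `X`, `Y` that they act on) such that `X̂'`, `Ŷ'` are copies of `X'`, `Y'` (so that `X'`,
`Y'` are classical) and `Pr(Y ≠ Y') = 1` or `Pr(X ≠ X') = 1`. -/
def IsQnmState {n : ℕ} {N' M' : Type} [Fintype N'] [Fintype M'] (k₁ k₂ : ℝ)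
    (ρ : SourceReg n (TamperedReg n N') (TamperedReg n M') → ℂ) : Prop :=
  ∃ (N M : Type) (_ : Fintype N) (_ : DecidableEq N) (_ : Fintype M) (_ : DecidableEq M)
    (σ : SourceReg n N M → ℂ)
    (U : Matrix (Bits n × TamperedReg n N') (Bits n × N) ℂ)
    (V : Matrix (Bits n × TamperedReg n M') (Bits n × M) ℂ),
    IsQmaState k₁ k₂ σ ∧ IsIsometry U ∧ IsSafe U ∧ IsIsometry V ∧ IsSafe V ∧
    ρ = ((U ⊗ₖ V) ⊗ₖ (1 : Matrix (Bits n × Bits n) (Bits n × Bits n) ℂ)).mulVec σ ∧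
    prob ρ (fun (((_, (x', xh', _)), (_, _)), (_, _)) => x' = xh') = 1 ∧
    prob ρ (fun (((_, _), (_, (y', yh', _))), (_, _)) => y' = yh') = 1 ∧
    (prob ρ (fun (((_, _), (y, (y', _, _))), (_, _)) => y ≠ y') = 1 ∨
      prob ρ (fun (((x, (x', _, _)), (_, _)), (_, _)) => x ≠ x') = 1)

/-- The state `ρ_{ext(X,Y) ext(X',Y') Y Y' M'}` of a pure state `ρ` on the registers
`X X' X̂' N' Y Y' Ŷ' M' X̂ Ŷ`. -/
def outputStateY {n m : ℕ} {N' M' : Type} [Fintype N'] [Fintype M']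
    (ext : Bits n → Bits n → Bits m)
    (ρ : SourceReg n (TamperedReg n N') (TamperedReg n M') → ℂ) :
    Matrix (Bits m × (Bits m × Bits n × Bits n × M')) (Bits m × (Bits m × Bits n × Bits n × M')) ℂ :=
  (classicalMap
    (fun ((x, y, x', y') : Bits n × Bits n × Bits n × Bits n) => (ext x y, ext x' y', y, y'))
    (partialTrace
      (fun (((x, y, x', y'), μ) : (Bits n × Bits n × Bits n × Bits n) × M')
          ((xh, yh, xh', yh', ν) : Bits n × Bits n × Bits n × Bits n × N') =>
        (((x, (x', xh', ν)), (y, (y', yh', μ))), (xh, yh)))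
      (ketbra ρ))).submatrix
    (fun (s, s', y, y', μ) => ((s, s', y, y'), μ)) (fun (s, s', y, y', μ) => ((s, s', y, y'), μ))

/-- The state `ρ_{ext(X,Y) ext(X',Y') X X' N'}` of a pure state `ρ` on the registers
`X X' X̂' N' Y Y' Ŷ' M' X̂ Ŷ`. -/
def outputStateX {n m : ℕ} {N' M' : Type} [Fintype N'] [Fintype M']
    (ext : Bits n → Bits n → Bits m)
    (ρ : SourceReg n (TamperedReg n N') (TamperedReg n M') → ℂ) :
    Matrix (Bits m × (Bits m × Bits n × Bits n × N')) (Bits m × (Bits m × Bits n × Bits n × N')) ℂ :=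
  (classicalMap
    (fun ((x, y, x', y') : Bits n × Bits n × Bits n × Bits n) => (ext x y, ext x' y', x, x'))
    (partialTrace
      (fun (((x, y, x', y'), ν) : (Bits n × Bits n × Bits n × Bits n) × N')
          ((xh, yh, xh', yh', μ) : Bits n × Bits n × Bits n × Bits n × M') =>
        (((x, (x', xh', ν)), (y, (y', yh', μ))), (xh, yh)))
      (ketbra ρ))).submatrix
    (fun (s, s', x, x', ν) => ((s, s', x, x'), ν)) (fun (s, s', x, x', ν) => ((s, s', x, x'), ν))

/-- `ext` is a `(k₁,k₂,ε)`-quantum secure two-source non-malleable extractor: for every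
`(k₁,k₂)`-qnm-state `ρ`,
`‖ρ_{ext(X,Y) ext(X',Y') Y Y' M'} - U_m ⊗ ρ_{ext(X',Y') Y Y' M'}‖₁ ≤ ε` and
`‖ρ_{ext(X,Y) ext(X',Y') X X' N'} - U_m ⊗ ρ_{ext(X',Y') X X' N'}‖₁ ≤ ε`. -/
def IsQuantumSecureTwoNmExt {n m : ℕ} (k₁ k₂ ε : ℝ) (ext : Bits n → Bits n → Bits m) : Prop :=
  ∀ (N' M' : Type) [Fintype N'] [DecidableEq N'] [Fintype M'] [DecidableEq M']
    (ρ : SourceReg n (TamperedReg n N') (TamperedReg n M') → ℂ),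
    IsQnmState k₁ k₂ ρ →
      distFromUniform (outputStateY ext ρ) ≤ ε ∧ distFromUniform (outputStateX ext ρ) ≤ ε

/-! ### Non-malleable codes in the split-state model -/

/-- `(enc, dec)` is a standard encoding and decoding scheme: `Pr(dec (enc s) = s) = 1` for every
message `s`. The value `none` of the decoder stands for the symbol `same`. -/
def IsStandardScheme {n m : ℕ} (enc : Bits m → PMF (Bits n × Bits n))
    (dec : Bits n → Bits n → Option (Bits m)) : Prop :=
  ∀ s, (enc s).map (fun c => dec c.1 c.2) (some s) = 1

/-- The state `σ_{SXY}` after a uniform message `S` has been encoded as `(X,Y) = enc S`. -/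
def encodedState {n m : ℕ} (enc : Bits m → PMF (Bits n × Bits n)) :
    Matrix (Bits m × (Bits n × Bits n)) (Bits m × (Bits n × Bits n)) ℂ :=
  Matrix.diagonal fun (s, c) => ((2 : ℂ) ^ m)⁻¹ * ((enc s c).toReal : ℂ)

/-- The state `ρ̂ = (U ⊗ V) (σ_{SXY} ⊗ |ψ⟩⟨ψ|_{NM}) (U ⊗ V)†` on the registers
`S (X' N') (Y' M')` after the action of the adversary `(U, V, ψ)`. -/
def tamperedState {n m : ℕ} {N M N' M' : Type} [Fintype N] [Fintype M]
    (enc : Bits m → PMF (Bits n × Bits n))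
    (U : Matrix (Bits n × N') (Bits n × N) ℂ) (V : Matrix (Bits n × M') (Bits n × M) ℂ)
    (ψ : N × M → ℂ) :
    Matrix (Bits m × ((Bits n × N') × (Bits n × M'))) (Bits m × ((Bits n × N') × (Bits n × M'))) ℂ :=
  let W := (1 : Matrix (Bits m) (Bits m) ℂ) ⊗ₖ (U ⊗ₖ V)
  W * (encodedState enc ⊗ₖ ketbra ψ).submatrix
      (fun (s, ((x, ν), (y, μ))) => ((s, (x, y)), (ν, μ)))
      (fun (s, ((x, ν), (y, μ))) => ((s, (x, y)), (ν, μ))) * W.conjTranspose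

/-- The final state `ρ_{SS'}`: in `ρ̂` the registers `X'` and `Y'` are measured in the computational
basis, and `S' = dec(X',Y')`. -/
def decodedState {n m : ℕ} {N M N' M' : Type} [Fintype N] [Fintype M] [Fintype N'] [Fintype M']
    (enc : Bits m → PMF (Bits n × Bits n)) (dec : Bits n → Bits n → Option (Bits m))
    (U : Matrix (Bits n × N') (Bits n × N) ℂ) (V : Matrix (Bits n × M') (Bits n × M) ℂ)
    (ψ : N × M → ℂ) :
    Matrix (Bits m × Option (Bits m)) (Bits m × Option (Bits m)) ℂ :=
  partialTrace (fun (p : Bits m × Option (Bits m)) (e : N' × M') => (p, e))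
    (classicalMap (fun ((s, x', y') : Bits m × Bits n × Bits n) => (s, dec x' y'))
      ((tamperedState enc U V ψ).submatrix
        (fun ((s, x', y'), (ν', μ')) => (s, ((x', ν'), (y', μ'))))
        (fun ((s, x', y'), (ν', μ')) => (s, ((x', ν'), (y', μ'))))))

/-- `copy (x, s) = s` if `x = same`, and `copy (x, s) = x` otherwise. -/
def copy {m : ℕ} (x : Option (Bits m)) (s : Bits m) : Option (Bits m) :=
  match x with
  | none => some s
  | some t => some t

/-- The classical state `Z copy(D, Z)`, where `Z` is uniform on `{0,1}^m` and independent of the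
random variable `D` on `{0,1}^m ∪ {same}`. -/
def simulatedState {m : ℕ} (D : PMF (Option (Bits m))) :
    Matrix (Bits m × Option (Bits m)) (Bits m × Option (Bits m)) ℂ :=
  Matrix.diagonal fun (z, t) => ((2 : ℂ) ^ m)⁻¹ * ((D.map (fun d => copy d z) t).toReal : ℂ)

/-- `(enc, dec)` is an `(m,n,ε)`-quantum secure non-malleable code in the split-state model: it is
a standard scheme and for every adversary `(U, V, ψ)`, with isometries `U : X N → X' N'`,
`V : Y M → Y' M'` and a shared pure state `ψ` on `N M`, there is a distribution `D` on
`{0,1}^m ∪ {same}` with `‖ρ_{SS'} - Z copy(D, Z)‖₁ ≤ ε`. -/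
def IsQuantumSecureNMCode {n m : ℕ} (enc : Bits m → PMF (Bits n × Bits n))
    (dec : Bits n → Bits n → Option (Bits m)) (ε : ℝ) : Prop :=
  IsStandardScheme enc dec ∧
  ∀ (N M N' M' : Type) [Fintype N] [DecidableEq N] [Fintype M] [DecidableEq M]
    [Fintype N'] [Fintype M']
    (U : Matrix (Bits n × N') (Bits n × N) ℂ) (V : Matrix (Bits n × M') (Bits n × M) ℂ)
    (ψ : N × M → ℂ),
    IsIsometry U → IsIsometry V → IsUnitVector ψ →
    ∃ D : PMF (Option (Bits m)),
      traceNorm (decodedState enc dec U V ψ - simulatedState D) ≤ ε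

/-- The encoder that sends `s` to a uniformly random element of the (non-empty) set `ext⁻¹(s)`. -/
def preimageEncoder {n m : ℕ} (ext : Bits n → Bits n → Bits m)
    (hext : ∀ s, ∃ x y, ext x y = s) (s : Bits m) : PMF (Bits n × Bits n) :=
  PMF.uniformOfFinset (Finset.univ.filter fun c : Bits n × Bits n => ext c.1 c.2 = s) (by
    obtain ⟨x, y, h⟩ := hext s
    exact ⟨(x, y), by simpa using h⟩)

end SplitState

end

/-! Replace the encoded message by two independent uniform sources `X`, `Y`, the message being `ext
X Y`. The adversary's action then becomes a family of amplitudes `G x y l r`. Since `U` and `V` are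
local isometries, summing over one party's outputs erases that party's input from the other party's
reduced operators (`isNonSignalling_tamperAmplitude`).

The probability space splits into `X' ≠ X`; `X' = X` with `Y' ≠ Y`; and `X' = X` with `Y' = Y`. Each
event is a left condition together with a right condition. Projecting on the condition of one's own
side leaves the other source uniform and independent. Projecting on the remaining condition only
decreases the operator, and renormalising an event of probability `p ≥ 2^(-k)` costs at most `k`
bits of min-entropy (`le_condMinEntropy`). So for the first two events the conditioned state is a
qnm-state (`isQnmState_eventState`), and the extractor makes the table of `(ext X Y, ext X' Y')`
close to uniform times its second marginal, with error `p * ε` (`sum_abs_eventTable_sub_le`). If `p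
< 2^(-k)`, the whole event is discarded. On the third event both messages coincide.

The simulator outputs the second marginal of the retained parts and `same` with the remaining
probability. Its error is computed in `sum_abs_sub_simulation_le`. Passing from uniform sources back
to the encoder rescales the rows of the table and costs another `ε`, because `ext` of uniform
sources is itself almost uniform (`sum_abs_preimageRatio_sub_le`). -/

open scoped Kronecker ComplexOrder
noncomputable section
namespace SplitState

/-! ### Trace norm and diagonals -/

/-- Pinching: the diagonal of a matrix is bounded in `ℓ¹` by the trace norm. -/
lemma sum_norm_diag_le_traceNorm {ι : Type*} [Fintype ι] [DecidableEq ι] (T : Matrix ι ι ℂ) :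
    ∑ i, ‖T i i‖ ≤ traceNorm T := by
  set hT := Matrix.isHermitian_conjTranspose_mul_self T
  set v := hT.eigenvectorBasis
  have hnorm : ∀ j, √(∑ i, ‖(T.mulVec (v j)) i‖ ^ 2) = √(hT.eigenvalues j) := by
    intro j
    congr 1
    have h1 : (T.conjTranspose * T).mulVec (v j) = (hT.eigenvalues j) • (v j : ι → ℂ) :=
      hT.mulVec_eigenvectorBasis j
    have h2 : star (T.mulVec (v j)) ⬝ᵥ (T.mulVec (v j))
        = hT.eigenvalues j * (star (v j : ι → ℂ) ⬝ᵥ (v j : ι → ℂ)) := by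
      rw [Matrix.star_mulVec, ← Matrix.dotProduct_mulVec, Matrix.mulVec_mulVec, h1,
        dotProduct_smul]
      simp
    have h3 : star (v j : ι → ℂ) ⬝ᵥ (v j : ι → ℂ) = 1 := by
      have := v.orthonormal.1 j
      have h4 := EuclideanSpace.norm_sq_eq (v j)
      rw [this] at h4
      simp only [dotProduct, Pi.star_apply, RCLike.star_def, Complex.conj_mul']
      exact_mod_cast h4.symm.trans (by norm_num)
    rw [h3, mul_one] at h2
    simp only [dotProduct, Pi.star_apply, RCLike.star_def, Complex.conj_mul'] at h2
    exact_mod_cast h2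
  -- Expanding `T = (T W) W†` in the unitary `W` of eigenvectors of `T† T` makes each diagonal entry
  -- a sum over `j`. Cauchy–Schwarz in `i` then bounds the `j`-th contribution by `‖T v_j‖`, the
  -- `j`-th singular value.
  have hdiag : ∀ i, T i i = ∑ j, (T.mulVec (v j)) i * star (v j i) := by
    intro i
    have hU := Matrix.mem_unitaryGroup_iff.mp hT.eigenvectorUnitary.2
    have : T = T * (hT.eigenvectorUnitary : Matrix ι ι ℂ)
        * star (hT.eigenvectorUnitary : Matrix ι ι ℂ) := by
      rw [Matrix.mul_assoc, hU, Matrix.mul_one]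
    conv_lhs => rw [this]
    simp only [Matrix.mul_apply, Matrix.star_apply, Matrix.IsHermitian.eigenvectorUnitary_apply,
      Matrix.mulVec, dotProduct]
    rfl
  calc ∑ i, ‖T i i‖ ≤ ∑ i, ∑ j, ‖(T.mulVec (v j)) i‖ * ‖v j i‖ := by
        gcongr with i
        rw [hdiag i]
        refine (norm_sum_le _ _).trans (le_of_eq ?_)
        simp
    _ = ∑ j, ∑ i, ‖(T.mulVec (v j)) i‖ * ‖v j i‖ := Finset.sum_comm
    _ ≤ ∑ j, √(hT.eigenvalues j) := by
        gcongr with j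
        refine (Real.sum_mul_le_sqrt_mul_sqrt _ _ _).trans (le_of_eq ?_)
        rw [hnorm, ← EuclideanSpace.norm_eq, v.orthonormal.1 j, mul_one]
    _ = traceNorm T := rfl

/-- The order of `eigenvalues` need not match the order of the diagonal, so the two are compared as
multisets of roots of the characteristic polynomial. -/
lemma traceNorm_diagonal {ι : Type*} [Fintype ι] [DecidableEq ι] (d : ι → ℂ) :
    traceNorm (Matrix.diagonal d) = ∑ i, ‖d i‖ := by
  unfold traceNorm
  generalize_proofs hA
  have hE : (Matrix.diagonal d).conjTranspose * Matrix.diagonal d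
      = Matrix.diagonal fun i => ((‖d i‖ ^ 2 : ℝ) : ℂ) := by
    rw [Matrix.diagonal_conjTranspose, Matrix.diagonal_mul_diagonal]
    congr 1
    ext i
    simp [Complex.conj_mul']
  have h1 := hA.roots_charpoly_eq_eigenvalues
  have h2 : ((Matrix.diagonal d).conjTranspose * Matrix.diagonal d).charpoly
      = (Multiset.map (fun a : ℂ => Polynomial.X - Polynomial.C a)
          (Finset.univ.val.map fun i => ((‖d i‖ ^ 2 : ℝ) : ℂ))).prod := by
    rw [hE, Matrix.charpoly_diagonal, Multiset.map_map]
    rfl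
  rw [h2, Polynomial.roots_multiset_prod_X_sub_C] at h1
  have h3 := congrArg (fun t : Multiset ℂ => (t.map fun z => √z.re).sum) h1
  simp only [Multiset.map_map, Function.comp_def] at h3
  have h4 : ∑ i, √((((‖d i‖ ^ 2 : ℝ) : ℂ)).re) = ∑ i, √(((hA.eigenvalues i : ℂ)).re) := h3
  simpa only [Complex.ofReal_re, Real.sqrt_sq (norm_nonneg _)] using h4.symm

/-! ### A lower bound on conditional min-entropy -/

/-- A pure state whose `A E`-marginal is dominated by `c ^ 2` times a product of the maximally
mixed state of `A` with a subnormalised state has large conditional min-entropy. -/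
lemma le_condMinEntropy {n : ℕ} {E B ι : Type*} [Fintype E] [DecidableEq E] [Fintype B]
    (k : ℝ) (g : Bits n × E → B → ι) (θ : ι → ℂ) (φ : Bits n × E → B → ℂ)
    (T : Matrix E E ℂ) (c : ℝ) (S : B → Prop) [DecidablePred S]
    (hφ : ∀ a e a' e', ∑ b, φ (a, e) b * star (φ (a', e') b) = if a = a' then T e e' else 0)
    (hpos : 0 < ∑ p, ∑ b, ‖φ p b‖ ^ 2) (hle : ∑ p, ∑ b, ‖φ p b‖ ^ 2 ≤ 1)
    (hc : c ^ 2 ≤ 2 ^ k) (hθ : ∀ p b, θ (g p b) = if S b then c * φ p b else 0) :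
    (((n : ℝ) - k : ℝ) : EReal) ≤ condMinEntropy (partialTrace g (ketbra θ)) := by
  set w : ℝ := ∑ e, ∑ b, ‖φ (fun _ => false, e) b‖ ^ 2 with hw
  have hTr : ∀ a, ∑ e, ∑ b, ‖φ (a, e) b‖ ^ 2 = w := by
    intro a
    rw [hw]
    congr 1
    ext e
    have h1 := hφ a e a e
    have h2 := hφ (fun _ => false) e (fun _ => false) e
    rw [if_pos rfl] at h1 h2
    have h3 := h1.trans h2.symm
    simp only [RCLike.star_def, Complex.mul_conj'] at h3
    exact_mod_cast h3
  have htot : ∑ p, ∑ b, ‖φ p b‖ ^ 2 = 2 ^ n * w := by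
    rw [Fintype.sum_prod_type]
    simp [hTr]
  rw [htot] at hpos hle
  have hw0 : 0 < w := by
    by_contra h
    have : (2 : ℝ) ^ n * w ≤ 0 := mul_nonpos_of_nonneg_of_nonpos (by positivity) (not_lt.mp h)
    linarith
  have hTsum : T = ∑ b, ketbra fun e => φ (fun _ => false, e) b := by
    ext e e'
    have := hφ (fun _ => false) e (fun _ => false) e'
    rw [if_pos rfl] at this
    simp [Matrix.sum_apply, ketbra, Matrix.vecMulVec_apply, ← this]
  have hTpsd : T.PosSemidef := by
    rw [hTsum]
    exact Matrix.posSemidef_sum _ fun b _ => Matrix.posSemidef_vecMulVec_self_star _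
  have hTtr : T.trace = w := by
    simp only [Matrix.trace, Matrix.diag]
    rw [hw]
    push_cast
    congr 1
    ext e
    have := hφ (fun _ => false) e (fun _ => false) e
    rw [if_pos rfl] at this
    simpa only [RCLike.star_def, Complex.mul_conj'] using this.symm
  -- The state `T / w` is the witness `τ` in the min-entropy; `w` is the trace of `T`, the same for
  -- every value of `a`.
  have hτ : IsDensity ((w⁻¹ : ℝ) • T) := by
    refine ⟨hTpsd.smul (by positivity), ?_⟩
    rw [Matrix.trace_smul, hTtr, Complex.real_smul, ← Complex.ofReal_mul, inv_mul_cancel₀ hw0.ne',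
      Complex.ofReal_one]
  have hM : ((((2 : ℝ) ^ (k - n) : ℝ) : ℂ) • ((1 : Matrix (Bits n) (Bits n) ℂ) ⊗ₖ ((w⁻¹ : ℝ) • T))
      - partialTrace g (ketbra θ)).PosSemidef := by
    -- Both operators are combinations of the same rank-one terms indexed by `b`, so positivity
    -- reduces to a comparison of scalar coefficients.
    have : ((((2 : ℝ) ^ (k - n) : ℝ) : ℂ) • ((1 : Matrix (Bits n) (Bits n) ℂ) ⊗ₖ ((w⁻¹ : ℝ) • T))
      - partialTrace g (ketbra θ))
        = ∑ b, ((2 : ℝ) ^ (k - n) * w⁻¹ - if S b then c ^ 2 else 0) • ketbra fun p => φ p b := by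
      ext ⟨a, e⟩ ⟨a', e'⟩
      simp only [Matrix.sub_apply, Matrix.smul_apply, Matrix.sum_apply, partialTrace,
        Matrix.of_apply, ketbra, Matrix.vecMulVec_apply, Pi.star_apply, hθ, sub_smul,
        Finset.sum_sub_distrib, ← Finset.smul_sum, hφ, Matrix.kroneckerMap_apply, Matrix.one_apply]
      congr 1
      · split_ifs <;> simp [mul_assoc]
      · refine Finset.sum_congr rfl fun b _ => ?_
        split_ifs
        · simp only [star_mul', RCLike.star_def, Complex.conj_ofReal, Complex.real_smul]
          push_cast
          ring
        · simp
    rw [this]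
    refine Matrix.posSemidef_sum _ fun b _ => (Matrix.posSemidef_vecMulVec_self_star _).smul ?_
    -- This is where `2 ^ n * w ≤ 1` enters.
    have h1 : (2 : ℝ) ^ k ≤ 2 ^ (k - n) * w⁻¹ := by
      rw [Real.rpow_sub two_pos, Real.rpow_natCast, div_mul_eq_mul_div, mul_div_assoc]
      refine le_mul_of_one_le_right (by positivity) ?_
      rw [le_div_iff₀ (by positivity), one_mul, le_inv_comm₀ (by positivity) hw0,
        ← one_div, le_div_iff₀ (by positivity)]
      linarith
    have : 0 ≤ c ^ 2 := sq_nonneg c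
    split_ifs <;> linarith
  have hinf : (⨅ τ : {τ : Matrix E E ℂ // IsDensity τ}, maxDivergence (partialTrace g (ketbra θ))
      ((1 : Matrix (Bits n) (Bits n) ℂ) ⊗ₖ (τ : Matrix E E ℂ))) ≤ ((k - n : ℝ) : EReal) := by
    refine (iInf_le _ ⟨_, hτ⟩).trans ?_
    unfold maxDivergence
    exact iInf_le_of_le ⟨k - n, hM⟩ le_rfl
  have := EReal.neg_le_neg_iff.mpr hinf
  rw [← EReal.coe_neg, neg_sub] at this
  exact this

/-! ### Non-signalling amplitudes and states conditioned on events -/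

/-- Joint amplitudes `G x y l r` of two parties with classical inputs `x`, `y` and outputs `l`, `r`
that are normalised for each pair of inputs, and such that the reduced operators of each party do
not depend on the input of the other one. -/
structure IsNonSignalling {X Y L R : Type*} [Fintype L] [Fintype R]
    (G : X → Y → L → R → ℂ) : Prop where
  left : ∀ y y₂ x x₂ l l₂,
    ∑ r, G x y l r * star (G x₂ y l₂ r) = ∑ r, G x y₂ l r * star (G x₂ y₂ l₂ r)
  right : ∀ x x₂ y y₂ r r₂,
    ∑ l, G x y l r * star (G x y₂ l r₂) = ∑ l, G x₂ y l r * star (G x₂ y₂ l r₂)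
  norm : ∀ x y, ∑ l, ∑ r, ‖G x y l r‖ ^ 2 = 1

lemma IsNonSignalling.swap {X Y L R : Type*} [Fintype L] [Fintype R]
    {G : X → Y → L → R → ℂ} (hG : IsNonSignalling G) :
    IsNonSignalling fun y x r l => G x y l r :=
  ⟨hG.right, hG.left, fun y x => by rw [Finset.sum_comm]; exact hG.norm x y⟩

variable {n m : ℕ} {N' M' : Type}

/-- The (unnormalised) purified state with uniform inputs, projected on an event. -/
def eventState (G : Bits n → Bits n → Bits n × N' → Bits n × M' → ℂ)
    (QL QR : Bits n → Bits n → Prop) [DecidableRel QL] [DecidableRel QR] (c : ℝ) :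
    SourceReg n (TamperedReg n N') (TamperedReg n M') → ℂ :=
  fun (((x, (x', xh', ν)), (y, (y', yh', μ))), (xh, yh)) =>
    if (xh = x ∧ xh' = x') ∧ (yh = y ∧ yh' = y') ∧ QL x x' ∧ QR y y' then
      c * ((2 ^ n)⁻¹ * G x y (x', ν) (y', μ)) else 0

lemma eventState_apply (G : Bits n → Bits n → Bits n × N' → Bits n × M' → ℂ)
    (QL QR : Bits n → Bits n → Prop) [DecidableRel QL] [DecidableRel QR] (c : ℝ)
    (x x' xh' : Bits n) (ν : N') (y y' yh' : Bits n) (μ : M') (xh yh : Bits n) :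
    eventState G QL QR c (((x, (x', xh', ν)), (y, (y', yh', μ))), (xh, yh)) =
      if (xh = x ∧ xh' = x') ∧ (yh = y ∧ yh' = y') ∧ QL x x' ∧ QR y y' then
        c * ((2 ^ n)⁻¹ * G x y (x', ν) (y', μ)) else 0 := rfl

lemma eventState_ne_zero {G : Bits n → Bits n → Bits n × N' → Bits n × M' → ℂ}
    {QL QR : Bits n → Bits n → Prop} [DecidableRel QL] [DecidableRel QR] {c : ℝ}
    {x x' xh' : Bits n} {ν : N'} {y y' yh' : Bits n} {μ : M'} {xh yh : Bits n}
    (h : eventState G QL QR c (((x, (x', xh', ν)), (y, (y', yh', μ))), (xh, yh)) ≠ 0) :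
    (xh = x ∧ xh' = x') ∧ (yh = y ∧ yh' = y') ∧ QL x x' ∧ QR y y' := by
  by_contra h'
  exact h (by rw [eventState_apply, if_neg h'])

/-- The joint amplitudes of a state conditioned on an event of the left party, arranged as a matrix
between the left side with the right input, and the rest of the right side. -/
def leftAmplitude (G : Bits n → Bits n → Bits n × N' → Bits n × M' → ℂ)
    (QL : Bits n → Bits n → Prop) [DecidableRel QL]
    (p : Bits n × (TamperedReg n N' × Bits n × Bits n)) (b : TamperedReg n M' × Bits n) : ℂ :=
  eventState G QL (fun _ _ => True) 1 (((p.2.2.1, p.2.1), (p.1, b.1)), (p.2.2.2, b.2))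

lemma leftAmplitude_apply (G : Bits n → Bits n → Bits n × N' → Bits n × M' → ℂ)
    (QL : Bits n → Bits n → Prop) [DecidableRel QL]
    (x x' xh' : Bits n) (ν : N') (y y' yh' : Bits n) (μ : M') (xh yh : Bits n) :
    leftAmplitude G QL (y, ((x', xh', ν), x, xh)) ((y', yh', μ), yh) =
      if (xh = x ∧ xh' = x' ∧ QL x x') ∧ (yh = y ∧ yh' = y') then
        (2 ^ n)⁻¹ * G x y (x', ν) (y', μ) else 0 := by
  rw [leftAmplitude, eventState_apply, Complex.ofReal_one, one_mul]
  congr 1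
  ext
  tauto

variable [Fintype N'] [Fintype M']

/-- The probability of `QL x x'` and `QR y y'` if the inputs `x`, `y` are uniform and `x'`, `y'` are
the measured first components of the outputs. -/
def eventProb (G : Bits n → Bits n → Bits n × N' → Bits n × M' → ℂ)
    (QL QR : Bits n → Bits n → Prop) [DecidableRel QL] [DecidableRel QR] : ℝ :=
  (4 ^ n)⁻¹ * ∑ x, ∑ y, ∑ l, ∑ r, if QL x l.1 ∧ QR y r.1 then ‖G x y l r‖ ^ 2 else 0

lemma sum_sourceReg {α : Type*} [AddCommMonoid α]
    (f : SourceReg n (TamperedReg n N') (TamperedReg n M') → α)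
    (hf : ∀ x x' xh' ν y y' yh' μ xh yh,
      ¬ ((xh = x ∧ xh' = x') ∧ (yh = y ∧ yh' = y')) →
      f (((x, (x', xh', ν)), (y, (y', yh', μ))), (xh, yh)) = 0) :
    ∑ i, f i = ∑ x, ∑ y, ∑ l : Bits n × N', ∑ r : Bits n × M',
      f (((x, (l.1, l.1, l.2)), (y, (r.1, r.1, r.2))), (x, y)) := by
  simp only [← Fintype.sum_prod_type']
  symm
  refine Fintype.sum_of_injective
    (fun p : Bits n × Bits n × (Bits n × N') × (Bits n × M') =>
      (((p.1, (p.2.2.1.1, p.2.2.1.1, p.2.2.1.2)),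
        (p.2.1, (p.2.2.2.1, p.2.2.2.1, p.2.2.2.2))), (p.1, p.2.1))) ?_ _ _ ?_ fun _ => rfl
  · rintro ⟨x, y, ⟨x', ν⟩, ⟨y', μ⟩⟩ ⟨x2, y2, ⟨x2', ν2⟩, ⟨y2', μ2⟩⟩ h
    simp only [Prod.mk.injEq] at h ⊢
    tauto
  · rintro ⟨⟨⟨x, x', xh', ν⟩, y, y', yh', μ⟩, xh, yh⟩ h
    refine hf _ _ _ _ _ _ _ _ _ _ fun h' => h ⟨(x, y, (x', ν), (y', μ)), ?_⟩
    obtain ⟨⟨rfl, rfl⟩, rfl, rfl⟩ := h'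
    rfl

lemma sum_congr₄ {X Y L R α : Type*} [Fintype X] [Fintype Y] [Fintype L] [Fintype R]
    [AddCommMonoid α] {f g : X → Y → L → R → α} (h : ∀ x y l r, f x y l r = g x y l r) :
    ∑ x, ∑ y, ∑ l, ∑ r, f x y l r = ∑ x, ∑ y, ∑ l, ∑ r, g x y l r := by
  simp only [h]

lemma sum_norm_sq_eventState (G : Bits n → Bits n → Bits n × N' → Bits n × M' → ℂ)
    (QL QR : Bits n → Bits n → Prop) [DecidableRel QL] [DecidableRel QR] (c : ℝ) :
    ∑ i, ‖eventState G QL QR c i‖ ^ 2 = c ^ 2 * eventProb G QL QR := by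
  rw [sum_sourceReg]
  · simp only [eventState, eventProb, Finset.mul_sum]
    refine sum_congr₄ fun x y l r => ?_
    simp only [true_and]
    split_ifs
    · have : (4 : ℝ) ^ n = (2 ^ n) ^ 2 := by rw [← pow_mul, mul_comm, pow_mul]; norm_num
      simp only [norm_mul, Complex.norm_real, norm_inv, norm_pow, Complex.norm_ofNat, mul_pow,
        Real.norm_eq_abs, sq_abs, this]
      ring
    · simp
  · intro x x' xh' ν y y' yh' μ xh yh h
    have : ¬((xh = x ∧ xh' = x') ∧ (yh = y ∧ yh' = y') ∧ QL x x' ∧ QR y y') := by tauto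
    simp [eventState, this]

lemma eventProb_mono (G : Bits n → Bits n → Bits n × N' → Bits n × M' → ℂ)
    (QL QR PL PR : Bits n → Bits n → Prop) [DecidableRel QL] [DecidableRel QR]
    [DecidableRel PL] [DecidableRel PR] (hL : ∀ x x', QL x x' → PL x x')
    (hR : ∀ x x', QR x x' → PR x x') :
    eventProb G QL QR ≤ eventProb G PL PR := by
  unfold eventProb
  gcongr with x _ y _ l _ r _
  split_ifs with h1 h2 h2
  · rfl
  · exact absurd ⟨hL _ _ h1.1, hR _ _ h1.2⟩ h2
  · positivity
  · rfl

lemma eventProb_true {G : Bits n → Bits n → Bits n × N' → Bits n × M' → ℂ}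
    (hG : IsNonSignalling G) : eventProb G (fun _ _ => True) (fun _ _ => True) = 1 := by
  simp only [eventProb, and_self, if_true, hG.norm]
  simp only [Finset.sum_const, Finset.card_univ, nsmul_eq_mul, mul_one]
  rw [← Nat.cast_mul, Fintype.card_fun, Fintype.card_bool, Fintype.card_fin, ← mul_pow]
  push_cast
  norm_num

lemma eventProb_le_one {G : Bits n → Bits n → Bits n × N' → Bits n × M' → ℂ}
    (hG : IsNonSignalling G) (QL QR : Bits n → Bits n → Prop) [DecidableRel QL]
    [DecidableRel QR] : eventProb G QL QR ≤ 1 :=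
  (eventProb_mono G QL QR _ _ (fun _ _ _ => trivial) fun _ _ _ => trivial).trans_eq
    (eventProb_true hG)

/-- The operator of the left side in `leftAmplitude`. -/
def leftMarginal (G : Bits n → Bits n → Bits n × N' → Bits n × M' → ℂ)
    (QL : Bits n → Bits n → Prop) [DecidableRel QL] :
    Matrix (TamperedReg n N' × Bits n × Bits n) (TamperedReg n N' × Bits n × Bits n) ℂ :=
  Matrix.of fun e e' =>
    if (e.2.2 = e.2.1 ∧ e.1.2.1 = e.1.1 ∧ QL e.2.1 e.1.1) ∧
        (e'.2.2 = e'.2.1 ∧ e'.1.2.1 = e'.1.1 ∧ QL e'.2.1 e'.1.1) then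
      ((2 : ℂ) ^ n)⁻¹ * ((2 : ℂ) ^ n)⁻¹ * ∑ r, G e.2.1 (fun _ => false) (e.1.1, e.1.2.2) r *
        star (G e'.2.1 (fun _ => false) (e'.1.1, e'.1.2.2) r) else 0

lemma sum_norm_sq_leftAmplitude (G : Bits n → Bits n → Bits n × N' → Bits n × M' → ℂ)
    (QL : Bits n → Bits n → Prop) [DecidableRel QL] :
    ∑ p, ∑ b, ‖leftAmplitude G QL p b‖ ^ 2 = eventProb G QL fun _ _ => True := by
  have h := sum_norm_sq_eventState G QL (fun _ _ => True) 1
  rw [one_pow, one_mul] at h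
  rw [← h, ← Fintype.sum_prod_type']
  let e : (Bits n × (TamperedReg n N' × Bits n × Bits n)) × (TamperedReg n M' × Bits n) ≃
      SourceReg n (TamperedReg n N') (TamperedReg n M') :=
    { toFun := fun q => (((q.1.2.2.1, q.1.2.1), (q.1.1, q.2.1)), (q.1.2.2.2, q.2.2))
      invFun := fun i => ((i.1.2.1, (i.1.1.2, i.1.1.1, i.2.1)), (i.1.2.2, i.2.2))
      left_inv := fun _ => rfl
      right_inv := fun _ => rfl }
  exact Fintype.sum_equiv e _ (fun i => ‖eventState G QL (fun _ _ => True) 1 i‖ ^ 2)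
    fun q => by rw [leftAmplitude]; rfl

/-- The copy `yh` lies in the register that is summed out, which kills the blocks with `y ≠ y₂`. On
the diagonal blocks non-signalling allows `y` to be replaced by the constant string that
`leftMarginal` uses. Hence the right input is uniform and independent of the left side, even after
the projection on `QL`. -/
lemma sum_leftAmplitude_mul_star {G : Bits n → Bits n → Bits n × N' → Bits n × M' → ℂ}
    (hG : IsNonSignalling G) (QL : Bits n → Bits n → Prop) [DecidableRel QL] (y y₂ : Bits n)
    (e e₂ : TamperedReg n N' × Bits n × Bits n) :
    ∑ b, leftAmplitude G QL (y, e) b * star (leftAmplitude G QL (y₂, e₂) b) =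
      if y = y₂ then leftMarginal G QL e e₂ else 0 := by
  obtain ⟨⟨x', xh', ν⟩, x, xh⟩ := e
  obtain ⟨⟨x₂', xh₂', ν₂⟩, x₂, xh₂⟩ := e₂
  split_ifs with hy
  · subst hy
    simp only [leftMarginal, Matrix.of_apply]
    rw [hG.left (fun _ => false) y, Finset.mul_sum]
    split_ifs with h
    · symm
      refine Fintype.sum_of_injective (fun r : Bits n × M' => ((r.1, r.1, r.2), y)) ?_ _ _ ?_ ?_
      · rintro ⟨a, b⟩ ⟨a2, b2⟩ h
        simp only [Prod.mk.injEq] at h ⊢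
        tauto
      · rintro ⟨⟨y', yh', μ⟩, yh⟩ h'
        rw [leftAmplitude_apply, if_neg, zero_mul]
        rintro ⟨-, rfl, rfl⟩
        exact h' ⟨(yh', μ), rfl⟩
      · rintro ⟨y', μ⟩
        rw [leftAmplitude_apply, leftAmplitude_apply, if_pos ⟨h.1, rfl, rfl⟩,
          if_pos ⟨h.2, rfl, rfl⟩]
        simp only [star_mul', star_inv₀, star_pow, star_ofNat]
        ring
    · refine Finset.sum_eq_zero ?_
      rintro ⟨⟨y', yh', μ⟩, yh⟩ -
      rw [leftAmplitude_apply, leftAmplitude_apply]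
      by_cases h1 : xh = x ∧ xh' = x' ∧ QL x x'
      · rw [if_neg (c := (xh₂ = x₂ ∧ _) ∧ _) fun h2 => h ⟨h1, h2.1⟩, star_zero, mul_zero]
      · rw [if_neg fun h2 => h1 h2.1, zero_mul]
  · refine Finset.sum_eq_zero ?_
    rintro ⟨⟨y', yh', μ⟩, yh⟩ -
    rw [leftAmplitude_apply, leftAmplitude_apply]
    by_cases h1 : yh = y
    · rw [if_neg (c := (xh₂ = x₂ ∧ _) ∧ _) fun h2 => hy (h1.symm.trans h2.2.1), star_zero,
        mul_zero]
    · rw [if_neg fun h2 => h1 h2.2.1, zero_mul]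

/-- The min-entropy of the right input of a conditioned state given the left side. -/
lemma le_condMinEntropy_eventState [DecidableEq N'] {ι : Type*}
    {G : Bits n → Bits n → Bits n × N' → Bits n × M' → ℂ} (hG : IsNonSignalling G)
    (QL QR : Bits n → Bits n → Prop) [DecidableRel QL] [DecidableRel QR] (k c : ℝ)
    (hc : c ^ 2 ≤ 2 ^ k) (hp : 0 < eventProb G QL QR) (θ : ι → ℂ)
    (g : Bits n × (TamperedReg n N' × Bits n × Bits n) → TamperedReg n M' × Bits n → ι)
    (hθ : ∀ x x' xh' ν y y' yh' μ xh yh,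
      θ (g (y, ((x', xh', ν), x, xh)) ((y', yh', μ), yh)) =
        if (xh = x ∧ xh' = x') ∧ (yh = y ∧ yh' = y') ∧ QL x x' ∧ QR y y' then
          c * ((2 ^ n)⁻¹ * G x y (x', ν) (y', μ)) else 0) :
    (((n : ℝ) - k : ℝ) : EReal) ≤ condMinEntropy (partialTrace g (ketbra θ)) := by
  have hle : eventProb G QL QR ≤ eventProb G QL fun _ _ => True :=
    eventProb_mono G QL QR _ _ (fun _ _ h => h) fun _ _ _ => trivial
  -- `QR` can be read off from `yh` and `y'`, both in the summed-out register `b`. Conditioning on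
  -- it therefore only drops terms of the sum over `b`.
  refine le_condMinEntropy k g θ (leftAmplitude G QL) (leftMarginal G QL)
    c (fun b => QR b.2 b.1.1) (fun y e y₂ e₂ => sum_leftAmplitude_mul_star hG QL y y₂ e e₂)
    ?_ ?_ hc ?_
  · rw [sum_norm_sq_leftAmplitude]; exact hp.trans_le hle
  · rw [sum_norm_sq_leftAmplitude]; exact eventProb_le_one hG _ _
  · rintro ⟨y, ⟨x', xh', ν⟩, x, xh⟩ ⟨⟨y', yh', μ⟩, yh⟩
    rw [hθ, leftAmplitude_apply, mul_ite, mul_zero, ← ite_and]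
    refine if_congr ⟨?_, ?_⟩ rfl rfl
    · rintro ⟨⟨rfl, rfl⟩, ⟨rfl, rfl⟩, h1, h2⟩
      exact ⟨h2, ⟨rfl, rfl, h1⟩, rfl, rfl⟩
    · rintro ⟨h2, ⟨rfl, rfl, h1⟩, rfl, rfl⟩
      exact ⟨⟨rfl, rfl⟩, ⟨rfl, rfl⟩, h1, h2⟩

/-! ### Conditioned states are qnm-states -/

lemma prob_eq_one {ι : Type*} [Fintype ι] {ψ : ι → ℂ} {P : ι → Prop} (hψ : IsUnitVector ψ)
    (h : ∀ i, ψ i ≠ 0 → P i) : prob ψ P = 1 := by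
  rw [← hψ, prob]
  refine Finset.sum_congr rfl fun i _ => ?_
  by_cases hi : ψ i = 0
  · simp [hi]
  · rw [if_pos (h i hi)]

lemma isSafe_one {X A : Type*} [DecidableEq X] [Fintype A] [DecidableEq A] :
    IsSafe (1 : Matrix (X × A) (X × A) ℂ) := by
  refine ⟨fun _ => 1, fun _ => by simp [IsIsometry], fun x' b x a => ?_⟩
  simp only [Matrix.one_apply, Prod.mk.injEq, ite_and]

lemma one_kronecker_one_kronecker_one_mulVec {A B C : Type*} [Fintype A] [Fintype B] [Fintype C]
    [DecidableEq A] [DecidableEq B] [DecidableEq C] (v : (A × B) × C → ℂ) :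
    (((1 : Matrix A A ℂ) ⊗ₖ (1 : Matrix B B ℂ)) ⊗ₖ (1 : Matrix C C ℂ)).mulVec v = v := by
  rw [Matrix.one_kronecker_one, Matrix.one_kronecker_one, Matrix.one_mulVec]

/-- Conditioning on a likely event that excludes `X' = X` or `Y' = Y` yields a qnm-state. -/
lemma isQnmState_eventState [DecidableEq N'] [DecidableEq M']
    {G : Bits n → Bits n → Bits n × N' → Bits n × M' → ℂ} (hG : IsNonSignalling G)
    (QL QR : Bits n → Bits n → Prop) [DecidableRel QL] [DecidableRel QR]
    (hQ : (∀ y y', QR y y' → y ≠ y') ∨ ∀ x x', QL x x' → x ≠ x') (k : ℝ)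
    (hp : (2 : ℝ) ^ (-k) ≤ eventProb G QL QR) :
    IsQnmState ((n : ℝ) - k) ((n : ℝ) - k) (eventState G QL QR (√(eventProb G QL QR))⁻¹) := by
  have hp0 : 0 < eventProb G QL QR := (Real.rpow_pos_of_pos two_pos _).trans_le hp
  set c := (√(eventProb G QL QR))⁻¹ with hc
  have hc2 : c ^ 2 = (eventProb G QL QR)⁻¹ := by rw [hc, inv_pow, Real.sq_sqrt hp0.le]
  have hck : c ^ 2 ≤ 2 ^ k := by
    rw [hc2, inv_le_comm₀ hp0 (by positivity), ← Real.rpow_neg two_pos.le]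
    exact hp
  have hunit : IsUnitVector (eventState G QL QR c) := by
    rw [IsUnitVector, sum_norm_sq_eventState, hc2, inv_mul_cancel₀ hp0.ne']
  -- The source state is the conditioned state itself: its side registers already contain the
  -- tampered sources, and the tampering isometries are identities.
  refine ⟨TamperedReg n N', TamperedReg n M', inferInstance, inferInstance, inferInstance,
    inferInstance, eventState G QL QR c, 1, 1, ⟨hunit, ?_, ?_, ?_, ?_⟩, ?_, isSafe_one, ?_,
    isSafe_one, ?_, ?_, ?_, ?_⟩
  · refine prob_eq_one hunit ?_
    rintro ⟨⟨⟨x, x', xh', ν⟩, y, y', yh', μ⟩, xh, yh⟩ h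
    exact (eventState_ne_zero h).1.1.symm
  · refine prob_eq_one hunit ?_
    rintro ⟨⟨⟨x, x', xh', ν⟩, y, y', yh', μ⟩, xh, yh⟩ h
    exact (eventState_ne_zero h).2.1.1.symm
  -- The entropy of `X` is the bound for `Y` with the two parties exchanged.
  · have hswap : eventProb (fun y x r l => G x y l r) QR QL = eventProb G QL QR := by
      unfold eventProb
      rw [Finset.sum_comm]
      congr 1
      refine Finset.sum_congr rfl fun x _ => Finset.sum_congr rfl fun y _ => ?_
      rw [Finset.sum_comm]
      simp only [and_comm]
    refine le_condMinEntropy_eventState hG.swap QR QL k c hck (by rw [hswap]; exact hp0) _ _ ?_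
    intro y y' yh' μ x x' xh' ν yh xh
    refine (eventState_apply G QL QR c x x' xh' ν y y' yh' μ xh yh).trans ?_
    refine if_congr ?_ rfl rfl
    tauto
  · refine le_condMinEntropy_eventState hG QL QR k c hck hp0 _ _ ?_
    intro x x' xh' ν y y' yh' μ xh yh
    exact eventState_apply G QL QR c x x' xh' ν y y' yh' μ xh yh
  · simp [IsIsometry]
  · simp [IsIsometry]
  · exact (one_kronecker_one_kronecker_one_mulVec _).symm
  · refine prob_eq_one hunit ?_
    rintro ⟨⟨⟨x, x', xh', ν⟩, y, y', yh', μ⟩, xh, yh⟩ h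
    exact (eventState_ne_zero h).1.2.symm
  · refine prob_eq_one hunit ?_
    rintro ⟨⟨⟨x, x', xh', ν⟩, y, y', yh', μ⟩, xh, yh⟩ h
    exact (eventState_ne_zero h).2.1.2.symm
  · refine hQ.imp (fun hQ => prob_eq_one hunit ?_) fun hQ => prob_eq_one hunit ?_
    · rintro ⟨⟨⟨x, x', xh', ν⟩, y, y', yh', μ⟩, xh, yh⟩ h
      exact hQ _ _ (eventState_ne_zero h).2.2.2
    · rintro ⟨⟨⟨x, x', xh', ν⟩, y, y', yh', μ⟩, xh, yh⟩ h
      exact hQ _ _ (eventState_ne_zero h).2.2.1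

/-! ### Security of the extractor as a bound on classical tables -/

/-- The joint subdistribution of `ext x y` and `ext x' y'` on an event. -/
def eventTable (ext : Bits n → Bits n → Bits m)
    (G : Bits n → Bits n → Bits n × N' → Bits n × M' → ℂ)
    (QL QR : Bits n → Bits n → Prop) [DecidableRel QL] [DecidableRel QR] (s s' : Bits m) : ℝ :=
  (4 ^ n)⁻¹ * ∑ x, ∑ y, ∑ l, ∑ r,
    if (QL x l.1 ∧ QR y r.1) ∧ ext x y = s ∧ ext l.1 r.1 = s' then ‖G x y l r‖ ^ 2 else 0

lemma sum_outputStateY_diag (ext : Bits n → Bits n → Bits m)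
    (ρ : SourceReg n (TamperedReg n N') (TamperedReg n M') → ℂ) (s s' : Bits m) :
    ∑ e : Bits n × Bits n × M', outputStateY ext ρ (s, s', e) (s, s', e) =
      ((∑ i, if ext i.1.1.1 i.1.2.1 = s ∧ ext i.1.1.2.1 i.1.2.2.1 = s' then ‖ρ i‖ ^ 2 else 0 : ℝ)
        : ℂ) := by
  have hdiag : ∀ e : Bits n × Bits n × M', outputStateY ext ρ (s, s', e) (s, s', e) =
      ∑ c : Bits n × Bits n × Bits n × Bits n, ∑ b : Bits n × Bits n × Bits n × Bits n × N',
        if (ext c.1 c.2.1, ext c.2.2.1 c.2.2.2, c.2.1, c.2.2.2) = (s, s', e.1, e.2.1) then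
          ((‖ρ (((c.1, (c.2.2.1, b.2.2.1, b.2.2.2.2)), (c.2.1, (c.2.2.2, b.2.2.2.1, e.2.2))),
            (b.1, b.2.1))‖ ^ 2 : ℝ) : ℂ) else 0 := by
    rintro ⟨y, y', μ⟩
    simp only [outputStateY, classicalMap, Matrix.submatrix_apply, Matrix.of_apply, if_true,
      partialTrace, ketbra, Matrix.vecMulVec_apply, Pi.star_apply, RCLike.star_def,
      Complex.mul_conj']
    refine Finset.sum_congr rfl fun c _ => ?_
    split_ifs
    · push_cast
      rfl
    · simp
  simp only [hdiag, ← Fintype.sum_prod_type']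
  push_cast
  symm
  refine Fintype.sum_of_injective
    (fun i : SourceReg n (TamperedReg n N') (TamperedReg n M') =>
      ((i.1.2.1, i.1.2.2.1, i.1.2.2.2.2), (i.1.1.1, i.1.2.1, i.1.1.2.1, i.1.2.2.1),
        (i.2.1, i.2.2, i.1.1.2.2.1, i.1.2.2.2.1, i.1.1.2.2.2))) ?_ _ _ ?_ ?_
  · rintro ⟨⟨⟨x, x', xh', ν⟩, y, y', yh', μ⟩, xh, yh⟩
      ⟨⟨⟨x2, x2', xh2', ν2⟩, y2, y2', yh2', μ2⟩, xh2, yh2⟩ h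
    simp only [Prod.mk.injEq] at h ⊢
    tauto
  · rintro ⟨⟨y0, y0', μ⟩, ⟨x, y, x', y'⟩, xh, yh, xh', yh', ν⟩ h
    rw [if_neg]
    intro h'
    simp only [Prod.mk.injEq] at h'
    obtain ⟨-, -, rfl, rfl⟩ := h'
    exact h ⟨(((x, (x', xh', ν)), (y, (y', yh', μ))), (xh, yh)), rfl⟩
  · rintro ⟨⟨⟨x, x', xh', ν⟩, y, y', yh', μ⟩, xh, yh⟩
    simp only [Prod.mk.injEq, and_true]
    split_ifs
    · push_cast
      rfl
    · simp

lemma sum_outputStateY_eventState (ext : Bits n → Bits n → Bits m)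
    (G : Bits n → Bits n → Bits n × N' → Bits n × M' → ℂ)
    (QL QR : Bits n → Bits n → Prop) [DecidableRel QL] [DecidableRel QR] (c : ℝ) (s s' : Bits m) :
    ∑ e : Bits n × Bits n × M',
      outputStateY ext (eventState G QL QR c) (s, s', e) (s, s', e) =
      ((c ^ 2 * eventTable ext G QL QR s s' : ℝ) : ℂ) := by
  rw [sum_outputStateY_diag, sum_sourceReg]
  · congr 1
    simp only [eventState_apply, eventTable, Finset.mul_sum, and_self, true_and]
    refine sum_congr₄ fun x y l r => ?_
    by_cases h1 : QL x l.1 ∧ QR y r.1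
    · simp only [h1, and_self, true_and, if_true]
      split_ifs
      · have : (4 : ℝ) ^ n = (2 ^ n) ^ 2 := by rw [← pow_mul, mul_comm, pow_mul]; norm_num
        simp only [norm_mul, Complex.norm_real, norm_inv, norm_pow, Complex.norm_ofNat, mul_pow,
          Real.norm_eq_abs, sq_abs, this]
        ring
      · simp
    · rw [if_neg h1, if_neg (c := (_ ∧ _) ∧ _ ) fun h => h1 h.1]
      simp
  · intro x x' xh' ν y y' yh' μ xh yh h
    have : ¬((xh = x ∧ xh' = x') ∧ (yh = y ∧ yh' = y') ∧ QL x x' ∧ QR y y') := by tauto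
    simp [eventState_apply, this]

/-- On a likely event that excludes `X' = X` or `Y' = Y`, the extracted message is almost uniform
given the message extracted from the tampered sources. -/
lemma sum_abs_eventTable_sub_le [DecidableEq N'] [DecidableEq M'] {k ε : ℝ}
    {ext : Bits n → Bits n → Bits m}
    (hsec : IsQuantumSecureTwoNmExt ((n : ℝ) - k) ((n : ℝ) - k) ε ext)
    {G : Bits n → Bits n → Bits n × N' → Bits n × M' → ℂ} (hG : IsNonSignalling G)
    (QL QR : Bits n → Bits n → Prop) [DecidableRel QL] [DecidableRel QR]
    (hQ : (∀ y y', QR y y' → y ≠ y') ∨ ∀ x x', QL x x' → x ≠ x')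
    (hp : (2 : ℝ) ^ (-k) ≤ eventProb G QL QR) :
    ∑ s, ∑ s', |eventTable ext G QL QR s s' - (2 ^ m)⁻¹ * ∑ t, eventTable ext G QL QR t s'| ≤
      eventProb G QL QR * ε := by
  have hp0 : 0 < eventProb G QL QR := (Real.rpow_pos_of_pos two_pos _).trans_le hp
  set c := (√(eventProb G QL QR))⁻¹ with hc
  have hc2 : c ^ 2 = (eventProb G QL QR)⁻¹ := by rw [hc, inv_pow, Real.sq_sqrt hp0.le]
  have h1 := (hsec N' M' _ (isQnmState_eventState hG QL QR hQ k hp)).1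
  rw [← hc] at h1
  set τ := outputStateY ext (eventState G QL QR c) with hτ
  -- Summing the diagonal entries over `e` discards the side information, by the triangle
  -- inequality. The diagonal is then controlled by the trace norm through pinching.
  have h2 : ∀ s s', (c ^ 2) * |eventTable ext G QL QR s s' -
      (2 ^ m)⁻¹ * ∑ t, eventTable ext G QL QR t s'| ≤
      ∑ e : Bits n × Bits n × M', ‖(τ - uniformState m ⊗ₖ
        partialTrace (fun e s => (s, e)) τ) (s, s', e) (s, s', e)‖ := by
    intro s s'
    refine le_trans (le_of_eq ?_) (norm_sum_le _ _)
    have : ∀ e : Bits n × Bits n × M', (τ - uniformState m ⊗ₖ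
        partialTrace (fun e s => (s, e)) τ) (s, s', e) (s, s', e) =
        τ (s, s', e) (s, s', e) - ((2 : ℂ) ^ m)⁻¹ * ∑ t, τ (t, s', e) (t, s', e) := by
      intro e
      simp [uniformState, partialTrace]
    simp only [this, Finset.sum_sub_distrib, ← Finset.mul_sum]
    rw [Finset.sum_comm, hτ]
    simp only [sum_outputStateY_eventState]
    rw [← abs_of_nonneg (sq_nonneg c), ← abs_mul, ← Real.norm_eq_abs, ← Complex.norm_real]
    congr 1
    push_cast [abs_of_nonneg (sq_nonneg c)]
    rw [← Finset.mul_sum]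
    ring
  have h3 : ∑ s, ∑ s', (c ^ 2) * |eventTable ext G QL QR s s' -
      (2 ^ m)⁻¹ * ∑ t, eventTable ext G QL QR t s'| ≤ ε := by
    refine (Finset.sum_le_sum fun s _ => Finset.sum_le_sum fun s' _ => h2 s s').trans ?_
    refine le_trans (le_of_eq ?_) ((sum_norm_diag_le_traceNorm _).trans h1)
    simp only [Fintype.sum_prod_type]
  simp only [← Finset.mul_sum] at h3
  rwa [hc2, inv_mul_le_iff₀ hp0] at h3

/-! ### The adversary's amplitudes and the decoded state -/

/-- The sum over `r` contracts `V† V = 1`. The injection `e` selects columns; it is used as `Prod.mk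
x`, which fixes the classical input. -/
lemma IsIsometry.sum_mul_star {A B M : Type*} [Fintype B] [DecidableEq A] [Fintype M]
    {V : Matrix B A ℂ} (hV : IsIsometry V) {e : M → A} (he : Function.Injective e)
    (a b : M → ℂ) :
    ∑ r, (∑ μ, V r (e μ) * a μ) * star (∑ μ, V r (e μ) * b μ) = ∑ μ, a μ * star (b μ) := by
  classical
  have h : ∀ μ μ₂, ∑ r, V r (e μ) * star (V r (e μ₂)) = if μ₂ = μ then 1 else 0 := by
    intro μ μ₂
    have := congrFun (congrFun hV (e μ₂)) (e μ)
    simp only [Matrix.mul_apply, Matrix.conjTranspose_apply, Matrix.one_apply, he.eq_iff] at this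
    rw [← this]
    exact Finset.sum_congr rfl fun r _ => mul_comm _ _
  calc _ = ∑ r, ∑ μ, ∑ μ₂, (V r (e μ) * star (V r (e μ₂))) * (a μ * star (b μ₂)) := by
        refine Finset.sum_congr rfl fun r _ => ?_
        rw [star_sum, Finset.sum_mul_sum]
        refine Finset.sum_congr rfl fun μ _ => Finset.sum_congr rfl fun μ₂ _ => ?_
        rw [star_mul']
        ring
    _ = ∑ μ, ∑ μ₂, (∑ r, V r (e μ) * star (V r (e μ₂))) * (a μ * star (b μ₂)) := by
        rw [Finset.sum_comm]
        refine Finset.sum_congr rfl fun μ _ => ?_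
        rw [Finset.sum_comm]
        simp only [Finset.sum_mul]
    _ = _ := by simp only [h, ite_mul, one_mul, zero_mul, Finset.sum_ite_eq',
        Finset.mem_univ, if_true]

lemma IsIsometry.sum_norm_sq {A B M : Type*} [Fintype B] [DecidableEq A] [Fintype M]
    {V : Matrix B A ℂ} (hV : IsIsometry V) {e : M → A} (he : Function.Injective e) (a : M → ℂ) :
    ∑ r, ‖∑ μ, V r (e μ) * a μ‖ ^ 2 = ∑ μ, ‖a μ‖ ^ 2 := by
  have := hV.sum_mul_star he a a
  simp only [RCLike.star_def, Complex.mul_conj'] at this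
  exact_mod_cast this

/-- The amplitude of the outputs `l`, `r` of the adversary `(U, V, ψ)` on the codeword `(x, y)`. -/
def tamperAmplitude {X Y N M L R : Type*} [Fintype N] [Fintype M] (U : Matrix L (X × N) ℂ)
    (V : Matrix R (Y × M) ℂ) (ψ : N × M → ℂ) (x : X) (y : Y) (l : L) (r : R) : ℂ :=
  ∑ μ, V r (y, μ) * ∑ ν, U l (x, ν) * ψ (ν, μ)

lemma tamperAmplitude_eq {X Y N M L R : Type*} [Fintype N] [Fintype M] (U : Matrix L (X × N) ℂ)
    (V : Matrix R (Y × M) ℂ) (ψ : N × M → ℂ) (x : X) (y : Y) (l : L) (r : R) :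
    tamperAmplitude U V ψ x y l r = ∑ ν, U l (x, ν) * ∑ μ, V r (y, μ) * ψ (ν, μ) := by
  simp only [tamperAmplitude, Finset.mul_sum]
  rw [Finset.sum_comm]
  exact Finset.sum_congr rfl fun ν _ => Finset.sum_congr rfl fun μ _ => mul_left_comm _ _ _

/-- Summing over a party's outputs contracts its isometry, and with it that party's input.
`tamperAmplitude` has the isometry `V` outermost and `tamperAmplitude_eq` has `U` outermost, one for
each direction. -/
lemma isNonSignalling_tamperAmplitude {X Y N M L R : Type*} [Fintype N] [Fintype M] [Fintype L]
    [Fintype R] [DecidableEq X] [DecidableEq Y] [DecidableEq N] [DecidableEq M]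
    {U : Matrix L (X × N) ℂ} {V : Matrix R (Y × M) ℂ} {ψ : N × M → ℂ}
    (hU : IsIsometry U) (hV : IsIsometry V) (hψ : IsUnitVector ψ) :
    IsNonSignalling (tamperAmplitude U V ψ) where
  left y y₂ x x₂ l l₂ := by
    simp only [tamperAmplitude, hV.sum_mul_star (Prod.mk_right_injective _)]
  right x x₂ y y₂ r r₂ := by
    simp only [tamperAmplitude_eq, hU.sum_mul_star (Prod.mk_right_injective _)]
  norm x y := by
    simp only [tamperAmplitude, hV.sum_norm_sq (Prod.mk_right_injective _)]
    rw [Finset.sum_comm]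
    simp only [hU.sum_norm_sq (Prod.mk_right_injective _)]
    rw [Finset.sum_comm, ← hψ, Fintype.sum_prod_type]

lemma tamperedState_diag {N M L R : Type} [Fintype N] [Fintype M]
    (enc : Bits m → PMF (Bits n × Bits n))
    (U : Matrix (Bits n × L) (Bits n × N) ℂ) (V : Matrix (Bits n × R) (Bits n × M) ℂ)
    (ψ : N × M → ℂ) (s : Bits m) (l : Bits n × L) (r : Bits n × R) :
    tamperedState enc U V ψ (s, (l, r)) (s, (l, r)) =
      ((∑ x, ∑ y, (2 ^ m)⁻¹ * (enc s (x, y)).toReal * ‖tamperAmplitude U V ψ x y l r‖ ^ 2 : ℝ)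
        : ℂ) := by
  -- The input is a mixture, over messages and codewords `c`, of the pure states `v c = |c⟩ ⊗ ψ`;
  -- the isometries act on each of them separately.
  set v : Bits m × (Bits n × Bits n) → Bits m × ((Bits n × N) × (Bits n × M)) → ℂ :=
    fun c k => if (k.1, k.2.1.1, k.2.2.1) = c then ψ (k.2.1.2, k.2.2.2) else 0 with hv
  have hM : (encodedState enc ⊗ₖ ketbra ψ).submatrix
      (fun ((s, ((x, ν), (y, μ))) : Bits m × ((Bits n × N) × (Bits n × M))) =>
        ((s, (x, y)), (ν, μ)))
      (fun ((s, ((x, ν), (y, μ))) : Bits m × ((Bits n × N) × (Bits n × M))) =>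
        ((s, (x, y)), (ν, μ)))
      = ∑ c, (((2 : ℂ) ^ m)⁻¹ * ((enc c.1 c.2).toReal : ℂ)) •
        Matrix.vecMulVec (v c) (star (v c)) := by
    ext ⟨s, ⟨x, ν⟩, y, μ⟩ ⟨s₂, ⟨x₂, ν₂⟩, y₂, μ₂⟩
    simp only [Matrix.submatrix_apply, Matrix.kroneckerMap_apply, encodedState,
      Matrix.diagonal_apply, ketbra, Matrix.vecMulVec_apply, Pi.star_apply, Matrix.sum_apply,
      Matrix.smul_apply, hv, smul_eq_mul]
    rw [Finset.sum_eq_single (s, x, y)]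
    · rw [if_pos rfl]
      by_cases h : (s, x, y) = (s₂, x₂, y₂)
      · rw [if_pos h, if_pos h.symm]
      · rw [if_neg h, if_neg fun h' => h h'.symm]
        simp
    · intro c _ hc
      rw [if_neg hc.symm]
      simp
    · simp
  have hW : ∀ c, ((1 : Matrix (Bits m) (Bits m) ℂ) ⊗ₖ (U ⊗ₖ V)).mulVec (v c) (s, (l, r)) =
      if s = c.1 then tamperAmplitude U V ψ c.2.1 c.2.2 l r else 0 := by
    rintro ⟨s₂, x, y⟩
    simp only [Matrix.mulVec, dotProduct, Matrix.kroneckerMap_apply, Matrix.one_apply, hv,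
      tamperAmplitude_eq, Fintype.sum_prod_type, Prod.mk.injEq, ite_and, ite_mul, mul_ite, one_mul,
      zero_mul, mul_zero, Finset.sum_ite_irrel, Finset.sum_const_zero,
      Finset.sum_ite_eq', Finset.mem_univ, if_true, Finset.mul_sum, mul_assoc]
  simp only [tamperedState]
  rw [hM, Matrix.mul_sum, Matrix.sum_mul]
  simp only [Matrix.mul_smul, Matrix.smul_mul, Matrix.mul_vecMulVec, Matrix.vecMulVec_mul,
    Matrix.sum_apply, Matrix.smul_apply, Matrix.vecMulVec_apply, ← Matrix.star_mulVec, hW,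
    Pi.star_apply]
  simp only [Fintype.sum_prod_type]
  rw [Finset.sum_eq_single s]
  · push_cast
    refine Finset.sum_congr rfl fun x _ => Finset.sum_congr rfl fun y _ => ?_
    rw [if_pos rfl, smul_eq_mul, RCLike.star_def, Complex.mul_conj']
  · intro t _ ht
    simp [ht.symm]
  · simp

/-- The joint distribution of the message and the decoded message. -/
def decodedTable (enc : Bits m → PMF (Bits n × Bits n))
    (dec : Bits n → Bits n → Option (Bits m))
    (G : Bits n → Bits n → Bits n × N' → Bits n × M' → ℂ) (p : Bits m × Option (Bits m)) : ℝ :=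
  ∑ l, ∑ r, if dec l.1 r.1 = p.2 then
    ∑ x, ∑ y, (2 ^ m)⁻¹ * (enc p.1 (x, y)).toReal * ‖G x y l r‖ ^ 2 else 0

/-- Both remaining registers are classical, so the trace distance in the definition of the code
becomes an `ℓ¹` distance of tables. -/
lemma decodedState_eq {N M : Type} [Fintype N] [Fintype M]
    (enc : Bits m → PMF (Bits n × Bits n)) (dec : Bits n → Bits n → Option (Bits m))
    (U : Matrix (Bits n × N') (Bits n × N) ℂ) (V : Matrix (Bits n × M') (Bits n × M) ℂ)
    (ψ : N × M → ℂ) :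
    decodedState enc dec U V ψ = Matrix.diagonal fun p =>
      (decodedTable enc dec (tamperAmplitude U V ψ) p : ℂ) := by
  ext ⟨s, t⟩ q
  simp only [decodedState, partialTrace, classicalMap, Matrix.of_apply, Matrix.submatrix_apply,
    tamperedState_diag, Matrix.diagonal_apply]
  split_ifs with h
  · simp only [decodedTable, ← Fintype.sum_prod_type']
    push_cast
    symm
    refine Fintype.sum_of_injective (fun i : (Bits n × N') × (Bits n × M') =>
      ((i.1.2, i.2.2), (s, i.1.1, i.2.1))) ?_ _ _ ?_ ?_
    · rintro ⟨⟨x', ν⟩, y', μ⟩ ⟨⟨x₂', ν₂⟩, y₂', μ₂⟩ h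
      simp only [Prod.mk.injEq] at h ⊢
      tauto
    · rintro ⟨⟨ν, μ⟩, s₂, x', y'⟩ h
      rw [if_neg]
      intro h'
      simp only [Prod.mk.injEq] at h'
      obtain ⟨rfl, -⟩ := h'
      exact h ⟨((x', ν), (y', μ)), rfl⟩
    · rintro ⟨⟨x', ν⟩, y', μ⟩
      simp only [Prod.mk.injEq, true_and]
      split_ifs
      · push_cast
        rfl
      · simp
  · simp

/-! ### Marginals of tables and the decomposition into events -/

lemma eventTable_nonneg (ext : Bits n → Bits n → Bits m)
    (G : Bits n → Bits n → Bits n × N' → Bits n × M' → ℂ)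
    (QL QR : Bits n → Bits n → Prop) [DecidableRel QL] [DecidableRel QR] (s s' : Bits m) :
    0 ≤ eventTable ext G QL QR s s' := by
  unfold eventTable
  positivity

lemma sum_sum_ite_and_eq {ι σ : Type*} [Fintype ι] [Fintype σ] [DecidableEq σ] (f : ι → ℝ)
    (b : ι → σ) (P : ι → Prop) [DecidablePred P] :
    ∑ s, ∑ i, (if P i ∧ b i = s then f i else 0) = ∑ i, if P i then f i else 0 := by
  rw [Finset.sum_comm]
  refine Finset.sum_congr rfl fun i _ => ?_
  by_cases h : P i <;> simp [h]

lemma sum_eventTable_right (ext : Bits n → Bits n → Bits m)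
    (G : Bits n → Bits n → Bits n × N' → Bits n × M' → ℂ)
    (QL QR : Bits n → Bits n → Prop) [DecidableRel QL] [DecidableRel QR] (s : Bits m) :
    ∑ s', eventTable ext G QL QR s s' = (4 ^ n)⁻¹ * ∑ x, ∑ y, ∑ l, ∑ r,
      if (QL x l.1 ∧ QR y r.1) ∧ ext x y = s then ‖G x y l r‖ ^ 2 else 0 := by
  have := sum_sum_ite_and_eq
    (fun i : Bits n × Bits n × (Bits n × N') × (Bits n × M') => ‖G i.1 i.2.1 i.2.2.1 i.2.2.2‖ ^ 2)
    (fun i => ext i.2.2.1.1 i.2.2.2.1)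
    (fun i => (QL i.1 i.2.2.1.1 ∧ QR i.2.1 i.2.2.2.1) ∧ ext i.1 i.2.1 = s)
  simp only [Fintype.sum_prod_type, and_assoc] at this
  simp only [eventTable, ← Finset.mul_sum, Fintype.sum_prod_type, and_assoc, this]

lemma sum_eventTable (ext : Bits n → Bits n → Bits m)
    (G : Bits n → Bits n → Bits n × N' → Bits n × M' → ℂ)
    (QL QR : Bits n → Bits n → Prop) [DecidableRel QL] [DecidableRel QR] :
    ∑ s, ∑ s', eventTable ext G QL QR s s' = eventProb G QL QR := by
  have := sum_sum_ite_and_eq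
    (fun i : Bits n × Bits n × (Bits n × N') × (Bits n × M') => ‖G i.1 i.2.1 i.2.2.1 i.2.2.2‖ ^ 2)
    (fun i => ext i.1 i.2.1)
    (fun i => QL i.1 i.2.2.1.1 ∧ QR i.2.1 i.2.2.2.1)
  simp only [Fintype.sum_prod_type, and_assoc] at this
  simp only [sum_eventTable_right, eventProb, ← Finset.mul_sum, Fintype.sum_prod_type, and_assoc,
    this]

/-- The number of preimages of a message, relative to the number of all codewords. -/
def preimageRatio (ext : Bits n → Bits n → Bits m) (s : Bits m) : ℝ :=
  (4 ^ n)⁻¹ * (Finset.univ.filter fun c : Bits n × Bits n => ext c.1 c.2 = s).card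

/-- The message extracted from uniform sources does not depend on a tampering that takes place
surely. -/
lemma sum_eventTable_right_eq_preimageRatio (ext : Bits n → Bits n → Bits m)
    {G : Bits n → Bits n → Bits n × N' → Bits n × M' → ℂ} (hG : IsNonSignalling G)
    (QL QR : Bits n → Bits n → Prop) [DecidableRel QL] [DecidableRel QR]
    (hQ : ∀ x y l r, G x y l r ≠ 0 → QL x l.1 ∧ QR y r.1) (s : Bits m) :
    ∑ s', eventTable ext G QL QR s s' = preimageRatio ext s := by
  rw [sum_eventTable_right, preimageRatio, Finset.card_filter, Fintype.sum_prod_type]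
  push_cast
  congr 1
  refine Finset.sum_congr rfl fun x _ => Finset.sum_congr rfl fun y _ => ?_
  split_ifs with hs
  · rw [← hG.norm x y]
    refine Finset.sum_congr rfl fun l _ => Finset.sum_congr rfl fun r _ => ?_
    by_cases h : G x y l r = 0
    · simp [h]
    · rw [if_pos ⟨hQ x y l r h, hs⟩]
  · simp [hs]

lemma eventProb_eq_one {G : Bits n → Bits n → Bits n × N' → Bits n × M' → ℂ}
    (hG : IsNonSignalling G) (QL QR : Bits n → Bits n → Prop) [DecidableRel QL] [DecidableRel QR]
    (hQ : ∀ x y l r, G x y l r ≠ 0 → QL x l.1 ∧ QR y r.1) : eventProb G QL QR = 1 := by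
  refine Eq.trans ?_ (eventProb_true hG)
  unfold eventProb
  refine congrArg (fun z : ℝ => (4 ^ n)⁻¹ * z) (sum_congr₄ fun x y l r => ?_)
  by_cases h : G x y l r = 0
  · rw [h, norm_zero, zero_pow two_ne_zero, ite_self, ite_self]
  · rw [if_pos (hQ x y l r h), if_pos ⟨trivial, trivial⟩]

/-- There is a tampering without fixed points of the left source. -/
lemma exists_isNonSignalling_ne (hn : 0 < n) :
    ∃ G : Bits n → Bits n → Bits n × Unit → Bits n × Unit → ℂ,
      IsNonSignalling G ∧ ∀ x y l r, G x y l r ≠ 0 → x ≠ l.1 ∧ True := by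
  -- The left party flips every bit, which has no fixed point since `n > 0`; the right party outputs
  -- a constant string.
  refine ⟨fun x _ l r => if l = (fun i => !(x i), ()) ∧ r = (fun _ => false, ()) then 1 else 0,
    ⟨fun _ _ _ _ _ _ => rfl, fun x x₂ y y₂ r r₂ => ?_, fun x y => ?_⟩, fun x y l r h => ?_⟩
  · simp only [ite_and, ite_mul, zero_mul, Finset.sum_ite_eq', Finset.mem_univ, if_true]
  · simp only [ite_and, apply_ite norm, norm_one, norm_zero, ite_pow, one_pow,
      zero_pow two_ne_zero, Finset.sum_ite_irrel, Finset.sum_const_zero, Finset.sum_ite_eq',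
      Finset.mem_univ, if_true]
  · refine ⟨fun hx => ?_, trivial⟩
    have h1 : l = (fun i => !(x i), ()) := (ite_ne_right_iff.mp h).1.1
    have := congrFun (hx.trans (congrArg Prod.fst h1)) ⟨0, hn⟩
    simp at this

/-- Uniform sources give an almost uniform message. -/
lemma sum_abs_preimageRatio_sub_le (hn : 0 < n) {k ε : ℝ} (hk : 0 ≤ k)
    {ext : Bits n → Bits n → Bits m}
    (hsec : IsQuantumSecureTwoNmExt ((n : ℝ) - k) ((n : ℝ) - k) ε ext) :
    ∑ s, |preimageRatio ext s - (2 ^ m)⁻¹| ≤ ε := by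
  -- Extractor security speaks only of tampered states, so a fixed-point-free tampering is
  -- introduced and then summed out. Its event has probability one, which is at least `2^(-k)`
  -- because `k ≥ 0`.
  obtain ⟨G, hG, hQ⟩ := exists_isNonSignalling_ne hn
  have hsum := sum_eventTable_right_eq_preimageRatio ext hG
    (fun x x' => x ≠ x') (fun _ _ => True) hQ
  have hp := eventProb_eq_one hG (fun x x' => x ≠ x') (fun _ _ => True) hQ
  have h1 := sum_abs_eventTable_sub_le hsec hG (fun x x' => x ≠ x') (fun _ _ => True)
    (Or.inr fun _ _ h => h) (by
      rw [hp]
      exact Real.rpow_le_one_of_one_le_of_nonpos one_le_two (by linarith))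
  rw [hp, one_mul] at h1
  have h2 := sum_eventTable ext G (fun x x' => x ≠ x') (fun _ _ => True)
  rw [hp, Finset.sum_comm] at h2
  refine le_trans (Finset.sum_le_sum fun s _ => ?_) h1
  rw [← hsum s]
  refine le_trans (le_of_eq ?_) (Finset.abs_sum_le_sum_abs _ _)
  rw [Finset.sum_sub_distrib, ← Finset.mul_sum, h2, mul_one]

/-- The asymmetric partition makes every event a conjunction of a left and a right condition, as
`eventState` requires; the event "`X` or `Y` changed" has no such form. -/
lemma eventTable_split (ext : Bits n → Bits n → Bits m)
    (G : Bits n → Bits n → Bits n × N' → Bits n × M' → ℂ) (s s' : Bits m) :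
    eventTable ext G (fun _ _ => True) (fun _ _ => True) s s' =
      eventTable ext G (fun x x' => x ≠ x') (fun _ _ => True) s s' +
      eventTable ext G (fun x x' => x = x') (fun y y' => y ≠ y') s s' +
      eventTable ext G (fun x x' => x = x') (fun y y' => y = y') s s' := by
  simp only [eventTable, ← mul_add, ← Finset.sum_add_distrib]
  refine congrArg (fun z : ℝ => (4 ^ n)⁻¹ * z) (sum_congr₄ fun x y l r => ?_)
  by_cases h1 : x = l.1 <;> by_cases h2 : y = r.1 <;> simp [h1, h2]

lemma eventTable_eq_of_ne (ext : Bits n → Bits n → Bits m)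
    (G : Bits n → Bits n → Bits n × N' → Bits n × M' → ℂ) {s s' : Bits m} (h : s ≠ s') :
    eventTable ext G (fun x x' => x = x') (fun y y' => y = y') s s' = 0 := by
  rw [eventTable, Finset.sum_eq_zero, mul_zero]
  refine fun x _ => Finset.sum_eq_zero fun y _ => Finset.sum_eq_zero fun l _ =>
    Finset.sum_eq_zero fun r _ => if_neg ?_
  rintro ⟨⟨h1, h2⟩, h3, h4⟩
  exact h (by rw [← h3, ← h4, h1, h2])

/-! ### Error of the simulation -/

/-- A table that is close to a product with the constant `u` if its mass is at least `η` splits into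
a part that is close to such a product and a part of mass at most `η`. -/
lemma exists_split {σ : Type*} [Fintype σ] {t : σ → σ → ℝ} {p η u ε : ℝ}
    (ht : ∀ s s', 0 ≤ t s s') (hp : ∑ s, ∑ s', t s s' = p) (hε : 0 ≤ ε) (hη : 0 ≤ η)
    (h : η ≤ p → ∑ s, ∑ s', |t s s' - u * ∑ r, t r s'| ≤ p * ε) :
    ∃ g b : σ → σ → ℝ, (∀ s s', t s s' = g s s' + b s s') ∧ (∀ s s', 0 ≤ g s s') ∧
      (∀ s s', 0 ≤ b s s') ∧ ∑ s, ∑ s', |g s s' - u * ∑ r, g r s'| ≤ p * ε ∧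
      ∑ s, ∑ s', b s s' ≤ η := by
  have hp0 : 0 ≤ p := hp ▸ Finset.sum_nonneg fun s _ => Finset.sum_nonneg fun s' _ => ht s s'
  by_cases hηp : η ≤ p
  · exact ⟨t, 0, by simp, ht, by simp, h hηp, by simpa using hη⟩
  · exact ⟨0, t, by simp, by simp, ht, by simpa using mul_nonneg hp0 hε,
      hp.le.trans (not_le.mp hηp).le⟩

/-- The distance between a table with uniform first marginal and its simulation, in terms of a
decomposition `g + b + d` of a nearby table `r` into a part that is close to a product, a small
part, and a diagonal part. -/
lemma sum_abs_sub_simulation_le {σ : Type*} [Fintype σ] [DecidableEq σ] {q r g b d : σ → σ → ℝ}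
    {u ε δ β : ℝ} (hr : ∀ s s', r s s' = g s s' + b s s' + d s s')
    (hb : ∀ s s', 0 ≤ b s s') (hd : ∀ s s', s ≠ s' → d s s' = 0)
    (hqr : ∑ s, ∑ s', |q s s' - r s s'| ≤ ε) (hru : ∑ s, |(∑ s', r s s') - u| ≤ ε)
    (hg : ∑ s, ∑ s', |g s s' - u * ∑ t, g t s'| ≤ δ) (hβ : ∑ s, ∑ s', b s s' ≤ β) :
    ∑ s, ∑ s', |q s s' - u * ((∑ t, g t s') +
      if s = s' then 1 - ∑ t', ∑ t, g t t' else 0)| ≤ 2 * ε + 2 * δ + 2 * β := by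
  set D : σ → ℝ := fun s' => ∑ t, g t s' with hD
  -- `d s s` is the sum of row `s` of `r` minus those of `g` and `b`. Replacing the row of `r` by
  -- `u` and that of `g` by `u * ∑ D` leaves `u * (1 - ∑ D)`, so each error is paid a second time.
  -- This explains the factor 2 in the conclusion.
  have h1 : ∀ s, ∑ s', |d s s' - u * (if s = s' then 1 - ∑ t, D t else 0)| ≤
      |(∑ s', r s s') - u| + ∑ s', |g s s' - u * D s'| + ∑ s', b s s' := by
    intro s
    rw [Finset.sum_eq_single s]
    · rw [if_pos rfl]
      have hds : d s s = ∑ s', d s s' :=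
        (Finset.sum_eq_single s (fun s' _ h => hd s s' h.symm) (by simp)).symm
      have : d s s - u * (1 - ∑ t, D t) = ((∑ s', r s s') - u) - (∑ s', (g s s' - u * D s'))
          - ∑ s', b s s' := by
        simp only [hds, hr, Finset.sum_add_distrib, Finset.sum_sub_distrib, ← Finset.mul_sum]
        ring
      rw [this]
      refine (abs_sub _ _).trans (add_le_add ((abs_sub _ _).trans (add_le_add le_rfl
        (Finset.abs_sum_le_sum_abs _ _))) (le_of_eq ?_))
      exact abs_of_nonneg (Finset.sum_nonneg fun s' _ => hb s s')
    · intro s' _ h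
      rw [hd s s' h.symm, if_neg h.symm]
      simp
    · simp
  have h2 : ∀ s s', |q s s' - u * (D s' + if s = s' then 1 - ∑ t, D t else 0)| ≤
      |q s s' - r s s'| + |g s s' - u * D s'| + b s s' +
        |d s s' - u * (if s = s' then 1 - ∑ t, D t else 0)| := by
    intro s s'
    have : q s s' - u * (D s' + if s = s' then 1 - ∑ t, D t else 0) =
        (q s s' - r s s') + (g s s' - u * D s') + b s s' +
        (d s s' - u * (if s = s' then 1 - ∑ t, D t else 0)) := by
      rw [hr]; ring
    rw [this]
    refine (abs_add_le _ _).trans (add_le_add ((abs_add_le _ _).trans (add_le_add (abs_add_le _ _)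
      (abs_of_nonneg (hb s s')).le)) le_rfl)
  have h3 := Finset.sum_le_sum fun s (_ : s ∈ Finset.univ) => Finset.sum_le_sum
    fun s' (_ : s' ∈ Finset.univ) => h2 s s'
  have h4 := Finset.sum_le_sum fun s (_ : s ∈ Finset.univ) => h1 s
  simp only [Finset.sum_add_distrib] at h3 h4
  linarith

/-! ### The preimage encoder and the simulator's distribution -/

lemma preimageRatio_pos {ext : Bits n → Bits n → Bits m} (hext : ∀ s, ∃ x y, ext x y = s)
    (s : Bits m) : 0 < preimageRatio ext s := by
  obtain ⟨x, y, h⟩ := hext s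
  have : 0 < (Finset.univ.filter fun c : Bits n × Bits n => ext c.1 c.2 = s).card :=
    Finset.card_pos.mpr ⟨(x, y), by simpa using h⟩
  unfold preimageRatio
  positivity

lemma toReal_preimageEncoder {ext : Bits n → Bits n → Bits m} (hext : ∀ s, ∃ x y, ext x y = s)
    (s : Bits m) (c : Bits n × Bits n) :
    (preimageEncoder ext hext s c).toReal =
      if ext c.1 c.2 = s then (4 ^ n)⁻¹ / preimageRatio ext s else 0 := by
  rw [preimageEncoder, PMF.uniformOfFinset_apply]
  simp only [Finset.mem_filter, Finset.mem_univ, true_and, preimageRatio]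
  split_ifs
  · rw [ENNReal.toReal_inv, ENNReal.toReal_natCast, div_mul_cancel_left₀ (by positivity)]
  · simp

lemma isStandardScheme_preimageEncoder {ext : Bits n → Bits n → Bits m}
    (hext : ∀ s, ∃ x y, ext x y = s) :
    IsStandardScheme (preimageEncoder ext hext) fun x y => some (ext x y) := by
  intro s
  rw [PMF.apply_eq_one_iff]
  ext t
  simp only [PMF.support_map, preimageEncoder, PMF.support_uniformOfFinset, Set.mem_image,
    Finset.mem_coe, Finset.mem_filter, Finset.mem_univ, true_and, Set.mem_singleton_iff]
  constructor
  · rintro ⟨c, rfl, rfl⟩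
    rfl
  · rintro rfl
    obtain ⟨x, y, h⟩ := hext s
    exact ⟨(x, y), h, by rw [h]⟩

/-- A uniform message followed by a uniform preimage is the uniform distribution on codewords,
reweighted by a factor that depends only on the message. The real table thus differs from that of
uniform sources only by row factors. -/
lemma decodedTable_some {ext : Bits n → Bits n → Bits m} (hext : ∀ s, ∃ x y, ext x y = s)
    (G : Bits n → Bits n → Bits n × N' → Bits n × M' → ℂ) (s s' : Bits m) :
    decodedTable (preimageEncoder ext hext) (fun x y => some (ext x y)) G (s, some s') =
      (2 ^ m)⁻¹ / preimageRatio ext s *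
        eventTable ext G (fun _ _ => True) (fun _ _ => True) s s' := by
  have h1 : eventTable ext G (fun _ _ => True) (fun _ _ => True) s s' =
      (4 ^ n)⁻¹ * ∑ l, ∑ r, ∑ x, ∑ y,
        if ext x y = s ∧ ext l.1 r.1 = s' then ‖G x y l r‖ ^ 2 else 0 := by
    simp only [eventTable, and_self, true_and]
    refine congrArg (fun z : ℝ => (4 ^ n)⁻¹ * z) ?_
    simp only [← Fintype.sum_prod_type']
    exact Fintype.sum_equiv
      { toFun := fun i => (i.2.2.1, i.2.2.2, i.1, i.2.1)
        invFun := fun i => (i.2.2.1, i.2.2.2, i.1, i.2.1)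
        left_inv := fun _ => rfl
        right_inv := fun _ => rfl } _ _ fun _ => rfl
  rw [h1]
  simp only [decodedTable, toReal_preimageEncoder, Finset.mul_sum, Option.some_inj]
  refine Finset.sum_congr rfl fun l _ => Finset.sum_congr rfl fun r _ => ?_
  split_ifs with h
  · refine Finset.sum_congr rfl fun x _ => Finset.sum_congr rfl fun y _ => ?_
    simp only [h, and_true]
    split_ifs
    · ring
    · simp
  · simp [h]

lemma decodedTable_none {ext : Bits n → Bits n → Bits m} (hext : ∀ s, ∃ x y, ext x y = s)
    (G : Bits n → Bits n → Bits n × N' → Bits n × M' → ℂ) (s : Bits m) :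
    decodedTable (preimageEncoder ext hext) (fun x y => some (ext x y)) G (s, none) = 0 := by
  simp [decodedTable]

lemma exists_pmf_option {σ : Type*} [Fintype σ] (D : σ → ℝ) (h0 : ∀ s, 0 ≤ D s)
    (h1 : ∑ s, D s ≤ 1) :
    ∃ P : PMF (Option σ), (∀ s, (P (some s)).toReal = D s) ∧ (P none).toReal = 1 - ∑ s, D s := by
  classical
  have hnn : ∀ o : Option σ, 0 ≤ o.elim (1 - ∑ s, D s) D := by
    rintro (_ | s)
    · exact sub_nonneg.mpr h1
    · exact h0 s
  refine ⟨PMF.ofFintype (fun o => ENNReal.ofReal (o.elim (1 - ∑ s, D s) D)) ?_, fun s => ?_, ?_⟩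
  · rw [← ENNReal.ofReal_sum_of_nonneg fun o _ => hnn o, Fintype.sum_option]
    simp
  · rw [PMF.ofFintype_apply, ENNReal.toReal_ofReal (hnn _)]; rfl
  · rw [PMF.ofFintype_apply, ENNReal.toReal_ofReal (hnn _)]; rfl

lemma toReal_map_copy_some (P : PMF (Option (Bits m))) (z t : Bits m) :
    ((P.map fun d => copy d z) (some t)).toReal =
      (P (some t)).toReal + if z = t then (P none).toReal else 0 := by
  rw [PMF.map_apply, tsum_fintype, Fintype.sum_option, ENNReal.toReal_add, add_comm]
  · congr 1
    · simp [copy]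
    · simp only [copy, Option.some_inj, eq_comm (a := t)]
      split_ifs <;> simp
  · split_ifs <;> simp [PMF.apply_ne_top]
  · refine (ENNReal.sum_lt_top.mpr fun i _ => ?_).ne
    split_ifs <;> simp [(PMF.apply_ne_top P _).lt_top]

lemma map_copy_none (P : PMF (Option (Bits m))) (z : Bits m) :
    (P.map fun d => copy d z) none = 0 := by
  rw [PMF.map_apply, tsum_fintype, Fintype.sum_option]
  simp [copy]

/-! ### Assembly -/

lemma isQuantumSecureNMCode_preimageEncoder (hn : 0 < n) {k ε : ℝ} (hk : 0 ≤ k)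
    {ext : Bits n → Bits n → Bits m} (hext : ∀ s, ∃ x y, ext x y = s)
    (hsec : IsQuantumSecureTwoNmExt ((n : ℝ) - k) ((n : ℝ) - k) ε ext) :
    IsQuantumSecureNMCode (preimageEncoder ext hext) (fun x y => some (ext x y))
      (4 * ((2 : ℝ) ^ (-k) + ε) + ε) := by
  refine ⟨isStandardScheme_preimageEncoder hext, ?_⟩
  intro N M N' M' _ _ _ _ _ _ U V ψ hU hV hψ
  classical
  set G := tamperAmplitude U V ψ with hGdef
  have hG : IsNonSignalling G := isNonSignalling_tamperAmplitude hU hV hψ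
  have hru := sum_abs_preimageRatio_sub_le hn hk hsec
  have hε : 0 ≤ ε := (Finset.sum_nonneg fun s _ => abs_nonneg _).trans hru
  have hη : (0 : ℝ) ≤ 2 ^ (-k) := (Real.rpow_pos_of_pos two_pos _).le
  obtain ⟨g₁, b₁, h₁, hg₁, hb₁, hδ₁, hβ₁⟩ := exists_split
    (eventTable_nonneg ext G (fun x x' => x ≠ x') (fun _ _ => True)) (sum_eventTable ..) hε hη
    (sum_abs_eventTable_sub_le hsec hG _ _ (Or.inr fun _ _ h => h))
  obtain ⟨g₂, b₂, h₂, hg₂, hb₂, hδ₂, hβ₂⟩ := exists_split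
    (eventTable_nonneg ext G (fun x x' => x = x') (fun y y' => y ≠ y')) (sum_eventTable ..) hε hη
    (sum_abs_eventTable_sub_le hsec hG _ _ (Or.inl fun _ _ h => h))
  set d := eventTable ext G (fun x x' => x = x') (fun y y' => y = y') with hd
  set r := eventTable ext G (fun _ _ => True) (fun _ _ => True) with hr
  have hsplit : ∀ s s', r s s' = (g₁ s s' + g₂ s s') + (b₁ s s' + b₂ s s') + d s s' := by
    intro s s'
    rw [hr, eventTable_split, h₁, h₂, ← hd]
    ring
  have hd0 : ∀ s s', 0 ≤ d s s' := fun s s' => eventTable_nonneg ..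
  have htot : ∑ s, ∑ s', r s s' = 1 := by rw [hr, sum_eventTable, eventProb_true hG]
  -- The two events are disjoint, so their errors `p₁ * ε` and `p₂ * ε` add up to at most `ε`.
  have hprob : eventProb G (fun x x' => x ≠ x') (fun _ _ => True) +
      eventProb G (fun x x' => x = x') (fun y y' => y ≠ y') ≤ 1 := by
    rw [← htot, ← sum_eventTable ext, ← sum_eventTable ext]
    simp only [← Finset.sum_add_distrib]
    refine Finset.sum_le_sum fun s _ => Finset.sum_le_sum fun s' _ => ?_
    rw [hr, eventTable_split]
    exact le_add_of_nonneg_right (hd0 s s')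
  have hmarg : ∀ s, ∑ s', r s s' = preimageRatio ext s := fun s =>
    sum_eventTable_right_eq_preimageRatio ext hG _ _ (fun _ _ _ _ _ => ⟨trivial, trivial⟩) s
  -- The simulator takes the column sums of the retained parts; all other mass, including that of
  -- discarded events, goes to `same`.
  obtain ⟨P, hPs, hPn⟩ := exists_pmf_option (fun s' => ∑ t, (g₁ t s' + g₂ t s'))
    (fun s' => Finset.sum_nonneg fun t _ => add_nonneg (hg₁ t s') (hg₂ t s')) (by
      rw [Finset.sum_comm, ← htot]
      refine Finset.sum_le_sum fun s _ => Finset.sum_le_sum fun s' _ => ?_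
      rw [hsplit]
      linarith [hb₁ s s', hb₂ s s', hd0 s s'])
  refine ⟨P, ?_⟩
  rw [decodedState_eq, simulatedState, Matrix.diagonal_sub, traceNorm_diagonal,
    Fintype.sum_prod_type]
  have hnorm : ∀ s, ∑ o, ‖((decodedTable (preimageEncoder ext hext) (fun x y => some (ext x y)) G
      (s, o) : ℝ) : ℂ) - ((2 : ℂ) ^ m)⁻¹ * (((P.map fun d => copy d s) o).toReal : ℂ)‖ =
      ∑ s', |(2 ^ m)⁻¹ / preimageRatio ext s * r s s' - (2 ^ m)⁻¹ *
        ((∑ t, (g₁ t s' + g₂ t s')) +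
          if s = s' then 1 - ∑ t', ∑ t, (g₁ t t' + g₂ t t') else 0)| := by
    intro s
    rw [Fintype.sum_option, decodedTable_none, map_copy_none]
    simp only [decodedTable_some, toReal_map_copy_some, hPs, hPn, ENNReal.toReal_zero,
      Complex.ofReal_zero, mul_zero, sub_zero, norm_zero, zero_add]
    refine Finset.sum_congr rfl fun s' _ => ?_
    rw [← Real.norm_eq_abs, ← Complex.norm_real]
    push_cast
    rfl
  rw [Finset.sum_congr rfl fun s _ => hnorm s]
  -- Row `s` of `r` has mass `preimageRatio ext s`, so rescaling it to mass `2^(-m)` moves exactly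
  -- `|preimageRatio ext s - 2^(-m)|`.
  have hqr : ∑ s, ∑ s', |(2 ^ m)⁻¹ / preimageRatio ext s * r s s' - r s s'| ≤ ε := by
    refine le_trans (le_of_eq (Finset.sum_congr rfl fun s _ => ?_)) hru
    have hpos := preimageRatio_pos hext s
    have : ∀ s', |(2 ^ m)⁻¹ / preimageRatio ext s * r s s' - r s s'| =
        |(2 ^ m)⁻¹ / preimageRatio ext s - 1| * r s s' := by
      intro s'
      rw [← sub_one_mul, abs_mul, abs_of_nonneg (eventTable_nonneg ext G _ _ s s')]
    rw [Finset.sum_congr rfl fun s' _ => this s', ← Finset.mul_sum, hmarg, abs_sub_comm]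
    nth_rw 2 [← abs_of_pos hpos]
    rw [← abs_mul, sub_mul, one_mul, div_mul_cancel₀ _ hpos.ne']
  -- Each of the two tampering events may discard mass `2^(-k)`, hence `β`. The total is `4 * ε + 4
  -- * 2^(-k)`; the stated bound exceeds it by `ε ≥ 0`.
  refine (sum_abs_sub_simulation_le hsplit (fun s s' => add_nonneg (hb₁ s s') (hb₂ s s'))
    (fun s s' h => eventTable_eq_of_ne ext G h) hqr (by simpa only [hmarg] using hru)
    (δ := ε) (β := 2 * 2 ^ (-k)) ?_ ?_).trans (by linarith)
  · calc ∑ s, ∑ s', |g₁ s s' + g₂ s s' - (2 ^ m)⁻¹ * ∑ t, (g₁ t s' + g₂ t s')|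
        ≤ ∑ s, ∑ s', (|g₁ s s' - (2 ^ m)⁻¹ * ∑ t, g₁ t s'| +
          |g₂ s s' - (2 ^ m)⁻¹ * ∑ t, g₂ t s'|) := by
          refine Finset.sum_le_sum fun s _ => Finset.sum_le_sum fun s' _ => ?_
          rw [Finset.sum_add_distrib, mul_add, add_sub_add_comm]
          exact abs_add_le _ _
      _ ≤ _ := by
          simp only [Finset.sum_add_distrib]
          have := mul_le_mul_of_nonneg_right hprob hε
          linarith
  · simp only [Finset.sum_add_distrib]
    linarith

end SplitState

end

theorem mainTheorem3 (n m : ℕ) (hn : 0 < n) (k ε : ℝ) (hk : 0 ≤ k)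
    (ext : SplitState.Bits n → SplitState.Bits n → SplitState.Bits m)
    (hext : ∀ s, ∃ x y, ext x y = s)
    (hsec : SplitState.IsQuantumSecureTwoNmExt ((n : ℝ) - k) ((n : ℝ) - k) ε ext) :
    SplitState.IsQuantumSecureNMCode (SplitState.preimageEncoder ext hext)
      (fun x y => some (ext x y)) (4 * ((2 : ℝ) ^ (-k) + ε) + ε) :=
  SplitState.isQuantumSecureNMCode_preimageEncoder hn hk hext hsec
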